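/- Let $d\ge 1$ be an integer, let $$1<p<p_{\mathrm{st}}(d):=\frac{d+2+\sqrt{d^2+12d+4}}{2d}$$ ($p_{\mathrm{st}}(d)$ is the Strauss exponent), and let $F:\mathbb C\to\mathbb C$ satisfy (A1) $F(0)=0$ and there is $C>0$ with $|F(z)-F(w)|\le C(|z|+|w|)^{p-1}|z-w|$ for all $z,w\in\mathbb C$; (A2) there are $c_0>0$ and $\theta\in\mathbb R$ with $\operatorname{Re}[e^{i\theta}F(z)]\ge c_0|z|^p$ for all $z\in\mathbb C$. Write $U(t)=e^{it\Delta/2}$ for the free Schrödinger group on $L^2(\mathbb R^d)$, and, for $s\in\mathbb R$, $\mathcal FH^s=\{f\in L^2(\mathbb R^d): (1+|x|^2)^{s/2}f\in L^2(\mathbb R^d)\}$. Let $\alpha>0$ satisfy $\frac{2}{p-1}-\frac d2\le\alpha$, let $u_0\in\mathcal FH^\alpha$, and let $u$ be a global forward-in-time $L^2$-solution of $$i\partial_t u+\tfrac12\Delta u=F(u),\qquad u(0)=u_0,$$ that is, $u\in C([0,\infty);L^2)\cap L^{q_0}_{\mathrm{loc}}([0,\infty);L^{r_0})$ with $(q_0,r_0)=\left(\frac{4(p+1)}{d(p-1)},\,p+1\right)$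 and $$u(t)=U(t)u_0-i\int_0^t U(t-s)F(u(s))\,ds\quad\text{in }L^2\text{ for all }t\ge 0$$ (where $U(t-s)F(u(s))$ is a tempered distribution and the integral is understood weakly, against Schwartz functions). Then the following hold. (i) If $p\le 2$, and $u_+\in L^2$ satisfies $\lim_{t\to\infty}\|u-U(\cdot)u_+\|_{L^\infty(t,\infty;L^2)}=0$, then $u_+=0$. (ii) If $p>2$ (which forces $d\le 2$), and $u_+\in\mathcal FH^\beta$ for some $\beta>\frac d2-\frac dp$ satisfies $$\lim_{t\to\infty}\left(t^{\frac{d(p-2)}{4p}}\,\|u-U(\cdot)u_+\|_{L^{\frac{4p}{d(p-2)}}(t,\infty;L^p)}\right)=0,$$ then $u_+=0$. -/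

import Mathlib

open MeasureTheory Filter Topology Set
open scoped ENNReal FourierTransform SchwartzMap

noncomputable section

namespace NLS

/-- The Euclidean space `ℝ^d`. -/
abbrev Space (d : ℕ) : Type := EuclideanSpace ℝ (Fin d)

/-- The complex Lebesgue space `L²(ℝ^d)`. -/
abbrev L2 (d : ℕ) : Type := Lp ℂ 2 (volume : Measure (Space d))

/-- The Strauss exponent `p_st(d) = (d + 2 + √(d² + 12 d + 4)) / (2 d)`. -/
def straussExponent (d : ℕ) : ℝ :=
  ((d : ℝ) + 2 + Real.sqrt ((d : ℝ) ^ 2 + 12 * d + 4)) / (2 * d)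

/-- The Lipschitz-type growth condition of order `p` on the nonlinearity. -/
def LipschitzType (p : ℝ) (F : ℂ → ℂ) : Prop :=
  F 0 = 0 ∧ ∃ C : ℝ, 0 < C ∧
    ∀ z w : ℂ, ‖F z - F w‖ ≤ C * (‖z‖ + ‖w‖) ^ (p - 1) * ‖z - w‖

/-- The non-oscillatory condition of order `p` on the nonlinearity. -/
def NonOscillatory (p : ℝ) (F : ℂ → ℂ) : Prop :=
  ∃ c₀ θ : ℝ, 0 < c₀ ∧
    ∀ z : ℂ, c₀ * ‖z‖ ^ p ≤ (Complex.exp (θ * Complex.I) * F z).re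

/-- Membership in the weighted space `𝓕H^s`: the function `⟨x⟩^s f` is in `L²`, where
`⟨x⟩ = (1 + |x|²)^{1/2}`. -/
def MemFH {d : ℕ} (s : ℝ) (f : L2 d) : Prop :=
  MemLp (fun x : Space d ↦ ((Real.sqrt (1 + ‖x‖ ^ 2) ^ s : ℝ) : ℂ) * f x) 2 volume

/-- The Fourier symbol of `e^{itΔ/2}`. The Fourier transform is normalized as
`∫ e^{-2πi x·ξ} f(x) dx`, so `Δ` has the symbol `-4π²|ξ|²`. -/
def freeSymbol {d : ℕ} (t : ℝ) (ξ : Space d) : ℂ :=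
  Complex.exp (-(2 * Real.pi ^ 2 * t * ‖ξ‖ ^ 2 : ℝ) * Complex.I)

theorem norm_freeSymbol {d : ℕ} (t : ℝ) (ξ : Space d) : ‖freeSymbol t ξ‖ = 1 := by
  rw [freeSymbol, ← Complex.ofReal_neg, Complex.norm_exp_ofReal_mul_I]

theorem continuous_freeSymbol {d : ℕ} (t : ℝ) :
    Continuous (freeSymbol t : Space d → ℂ) := by
  unfold freeSymbol
  fun_prop

theorem memLp_freeSymbol_mul {d : ℕ} (t : ℝ) (f : L2 d) :
    MemLp (fun ξ ↦ freeSymbol t ξ * f ξ) 2 volume :=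
  (Lp.memLp f).of_le
    ((continuous_freeSymbol t).aestronglyMeasurable.mul (Lp.aestronglyMeasurable f))
    (Eventually.of_forall fun ξ ↦ by rw [norm_mul, norm_freeSymbol, one_mul])

/-- The free Schrödinger evolution operator `U(t) = e^{itΔ/2}` on `L²(ℝ^d)`. -/
def U {d : ℕ} (t : ℝ) (f : L2 d) : L2 d :=
  𝓕⁻ ((memLp_freeSymbol_mul t (𝓕 f)).toLp)

/-- The mixed norm of `v` in `L^q(J; L^r(ℝ^d))`, with values in `[0, ∞]`. -/
def mixedNorm {d : ℕ} (q r : ℝ≥0∞) (J : Set ℝ) (v : ℝ → L2 d) : ℝ≥0∞ :=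
  eLpNorm (fun s ↦ eLpNorm (v s) r volume) q (volume.restrict J)

/-- `u` is a solution of `i ∂ₜ u + ½ Δ u = F(u)`, `u(0) = u₀`, on the interval `I ∋ 0`: it belongs
to `C(I; L²) ∩ L^{q₀}_loc(I; L^{r₀})`, `(q₀, r₀) = (4(p+1)/(d(p-1)), p+1)`, and satisfies
`u(t) = U(t) u₀ - i ∫₀ᵗ U(t-s) F(u(s)) ds` for all `t ∈ I`.

For almost every `s` the function `F(u(s))` is in `L^{(p+1)/p}`, in general not in `L²`. So
`U(t-s) F(u(s))` is the tempered distribution `φ ↦ ∫ F(u(s)) U(t-s)φ dx` (the operator `U` is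
symmetric for the bilinear pairing `∫ f g dx`), and the integral in time is the weak one, tested
against every Schwartz function `φ`. As the left-hand side and `U(t) u₀` are in `L²`, this is an
identity in `L²`. -/
structure IsSolution {d : ℕ} (p : ℝ) (F : ℂ → ℂ) (I : Set ℝ) (u₀ : L2 d) (u : ℝ → L2 d) :
    Prop where
  continuousOn : ContinuousOn u I
  locallyIntegrable : ∀ K ⊆ I, IsCompact K →
    mixedNorm (ENNReal.ofReal (4 * (p + 1) / (d * (p - 1)))) (ENNReal.ofReal (p + 1)) K u < ∞
  duhamel : ∀ t ∈ I, ∀ φ : 𝓢(Space d, ℂ),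
    ∫ x, u t x * φ x =
      (∫ x, U t u₀ x * φ x) -
        Complex.I * ∫ s in (0 : ℝ)..t, ∫ x, F (u s x) * U (t - s) (φ.toLp 2 volume) x

end NLS

end

/-!
The idea is to bound the space-time integral of `|u|^p` over a light cone from above and from below,
and to see that below the Strauss exponent the two bounds contradict each other unless the
scattering state vanishes.

**Upper bound** (`IsSolution.exists_upper_bound`). Duhamel's formula is tested with a real weight
`φ` of width `R` on the time interval `[0, t]`, `t ≤ δ R²`. On this parabolic scale `U(t - s) φ` is
close to `φ`, so that by the non-oscillatory condition `∫₀ᵗ ∫ |u|^p φ` is bounded by the pairings of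
`u(t)` and of `U(t) u₀` with `φ`. Hölder's inequality turns this into `∫₀ᵗ Y ≤ A + B Y(t)^{1/p}`,
`Y(t) = ∫ |u(t)|^p φ`, and an inequality of this kind on `[0, T]` bounds `∫ Y` over `[0, T/2]`
(`lintegral_le_of_le_add_rpow`). The outcome is `R^γ + R^{d - 2/(p-1)}` up to a constant, for every
`γ ∈ [0, d]` with `γ > d/2 - α`; the first term is the contribution of `u₀ ∈ 𝓕H^α`.

The error `U(t - s) φ - φ` has to be absorbed pointwise, because `F(u)` is controlled only through
`∫ |u|^p φ`. For a Gaussian `φ` this fails: the free evolution spreads, and the error is dominated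
by a wider Gaussian only (`exists_norm_freeGaussian_sub_le`). So `φ` is a finite sum of Gaussians of
widths `2ᵏ R`, `k ≤ n`, in which the error of each summand is dominated by the next summand
(`exists_norm_U_weight_sub_le`). The last error, at scale `2ⁿ⁺¹ R`, tends to zero as `n → ∞`, as
`u ∈ L^{p+1}_loc` in space-time (`exists_coarse_scale_le`). All evolved weights are explicit.

**Lower bound** (`exists_lower_bound`). If `u₊ ≠ 0`, some translate `g` of the unit Gaussian has
`κ = |⟨g, u₊⟩| > 0`. Since `⟨g, u₊⟩ = ⟨U(s) g, U(s) u₊⟩`, and `U(s) g` has height `s^{-d/2}` and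
width `s` (`norm_freeGaussian_le`), the pairing `⟨U(s) g, u(s)⟩` is at least `κ/2` in absolute value
whenever the remainder `u(s) - U(s) u₊` is small. Asymptotic freeness makes it small for at least
half of the times in `(ρ, 2ρ)`, and Hölder's inequality then gives
`∫_ρ^{2ρ} ∫ |u|^p φ ≳ ρ^{1 + d - dp/2}` for a Gaussian `φ` of width comparable to `ρ`. Part (i)
measures the remainder in `L²`, part (ii) in `L^p`.

**Comparison.** With `R` comparable to `ρ`, the cone lies in the parabolic region for large `ρ`. The
condition `p < p_st(d)` is `d p² - (d + 2) p < 2`, which says precisely that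
`d - 2/(p-1) < 1 + d - dp/2`; and `α ≥ 2/(p-1) - d/2` allows a `γ` below the same exponent.
-/

namespace NLS

variable {d : ℕ}

/-! ### Gaussians as Schwartz functions -/

theorem exists_pow_mul_exp_neg_mul_sq_le (k : ℕ) {b : ℝ} (hb : 0 < b) :
    ∃ C : ℝ, ∀ r : ℝ, 0 ≤ r → (1 + r) ^ k * Real.exp (-b * r ^ 2) ≤ C := by
  have h2 : Tendsto (fun r : ℝ ↦ r ^ k * Real.exp (-r)) atTop (𝓝 0) :=
    Real.tendsto_pow_mul_exp_neg_atTop_nhds_zero k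
  obtain ⟨C, hC⟩ : ∃ C, ∀ r : ℝ, 0 ≤ r → (1 + r) ^ k * Real.exp (-(1 + r)) ≤ C := by
    obtain ⟨M, hM⟩ := (h2.eventually (gt_mem_nhds one_pos)).exists_forall_of_atTop
    obtain ⟨D, hD⟩ := (isCompact_Icc (a := (0 : ℝ)) (b := M)).exists_bound_of_continuousOn
      (f := fun r : ℝ ↦ r ^ k * Real.exp (-r)) (by fun_prop)
    refine ⟨max D 1, fun r hr ↦ ?_⟩
    rcases le_total M (1 + r) with h | h
    · exact (hM _ h).le.trans (le_max_right _ _)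
    · exact ((le_abs_self _).trans (hD _ ⟨by linarith, h⟩)).trans (le_max_left _ _)
  refine ⟨C * Real.exp (1 + 1 / (4 * b)), fun r hr ↦ ?_⟩
  have h3 : Real.exp (-b * r ^ 2) ≤ Real.exp (-(1 + r)) * Real.exp (1 + 1 / (4 * b)) := by
    rw [← Real.exp_add, Real.exp_le_exp]
    have : b * r ^ 2 - r + 1 / (4 * b) = b * (r - 1 / (2 * b)) ^ 2 := by field_simp; ring
    have := mul_nonneg hb.le (sq_nonneg (r - 1 / (2 * b)))
    linarith
  calc _ ≤ (1 + r) ^ k * (Real.exp (-(1 + r)) * Real.exp (1 + 1 / (4 * b))) := by gcongr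
    _ = (1 + r) ^ k * Real.exp (-(1 + r)) * Real.exp (1 + 1 / (4 * b)) := by ring
    _ ≤ _ := by gcongr; exact hC r hr

/-- The Gaussian `exp (-a |x|²)`, `a > 0`, as a Schwartz function. -/
noncomputable def schwartzGaussian (d : ℕ) (a : ℝ) (ha : 0 < a) : 𝓢(Space d, ℂ) where
  toFun x := ((Real.exp (-a * ‖x‖ ^ 2) : ℝ) : ℂ)
  smooth' := by
    have : ContDiff ℝ ((⊤ : ℕ∞) : WithTop ℕ∞) (fun x : Space d ↦ Real.exp (-a * ‖x‖ ^ 2)) :=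
      (contDiff_const.mul (contDiff_norm_sq ℝ)).exp
    exact Complex.ofRealCLM.contDiff.comp this
  decay' k n := by
    obtain ⟨l, K, hK, hf⟩ := (Function.hasTemperateGrowth_norm_sq
      (H := Space d)).norm_iteratedFDeriv_le_uniform n
    obtain ⟨C, hC⟩ := exists_pow_mul_exp_neg_mul_sq_le (k + l * n) ha
    have hg : ContDiff ℝ ((⊤ : ℕ∞) : WithTop ℕ∞) (fun s : ℝ ↦ ((Real.exp (-a * s) : ℝ) : ℂ)) :=
      Complex.ofRealCLM.contDiff.comp (contDiff_const.mul contDiff_id).exp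
    have hgi : ∀ i s, ‖iteratedFDeriv ℝ i (fun s : ℝ ↦ ((Real.exp (-a * s) : ℝ) : ℂ)) s‖
        = a ^ i * Real.exp (-a * s) := by
      intro i s
      have h0 : (fun s : ℝ ↦ ((Real.exp (-a * s) : ℝ) : ℂ))
          = Complex.ofRealLI ∘ (fun s : ℝ ↦ Real.exp (-a * s)) := rfl
      rw [h0, LinearIsometry.norm_iteratedFDeriv_comp_left _
        (f := fun s : ℝ ↦ Real.exp (-a * s)) (n := i)
        ((contDiff_const.mul contDiff_id).exp.contDiffAt) le_rfl,
        norm_iteratedFDeriv_eq_norm_iteratedDeriv]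
      have := iteratedDeriv_comp_const_mul (n := i) (f := Real.exp) Real.contDiff_exp (-a)
      rw [this]
      simp [iteratedDeriv_eq_iterate, abs_of_pos ha]
    refine ⟨n.factorial * (1 + a) ^ n * (1 + K) ^ n * C, fun x ↦ ?_⟩
    have h := norm_iteratedFDeriv_comp_le (n := n) (N := ((⊤ : ℕ∞) : WithTop ℕ∞)) hg
      (contDiff_norm_sq ℝ (E := Space d)) (by exact_mod_cast le_top) x
      (C := (1 + a) ^ n * Real.exp (-a * ‖x‖ ^ 2))
      (D := (1 + K) * (1 + ‖x‖) ^ l) ?_ ?_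
    · have h' : ‖iteratedFDeriv ℝ n (fun x : Space d ↦ ((Real.exp (-a * ‖x‖ ^ 2) : ℝ) : ℂ)) x‖ ≤
        n.factorial * ((1 + a) ^ n * Real.exp (-a * ‖x‖ ^ 2)) * ((1 + K) * (1 + ‖x‖) ^ l) ^ n := h
      calc _ ≤ (1 + ‖x‖) ^ k * (n.factorial * ((1 + a) ^ n * Real.exp (-a * ‖x‖ ^ 2)) *
            ((1 + K) * (1 + ‖x‖) ^ l) ^ n) := by
            gcongr
            linarith
        _ = n.factorial * (1 + a) ^ n * (1 + K) ^ n *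
            ((1 + ‖x‖) ^ (k + l * n) * Real.exp (-a * ‖x‖ ^ 2)) := by
            rw [mul_pow, ← pow_mul, pow_add]; ring
        _ ≤ _ := by gcongr; exact hC _ (norm_nonneg _)
    · intro i hi
      rw [hgi]
      gcongr
      calc a ^ i ≤ (1 + a) ^ i := by gcongr; linarith
        _ ≤ _ := pow_le_pow_right₀ (by linarith) hi
    · intro i hi hin
      have h1 : 1 ≤ (1 + ‖x‖) ^ l := one_le_pow₀ (by linarith [norm_nonneg x])
      calc _ ≤ K * (1 + ‖x‖) ^ l := hf i hin x
        _ ≤ (1 + K) * (1 + ‖x‖) ^ l := by gcongr; linarith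
        _ ≤ _ := le_self_pow₀ (by nlinarith) (by lia)

@[simp]
theorem schwartzGaussian_apply (a : ℝ) (ha : 0 < a) (x : Space d) :
    schwartzGaussian d a ha x = ((Real.exp (-a * ‖x‖ ^ 2) : ℝ) : ℂ) := rfl

/-! ### The bilinear pairing and the Fourier transform on `L²` -/

theorem integral_mul_eq_inner (f g : L2 d) : ∫ x, f x * g x = inner ℂ (star f) g := by
  rw [L2.inner_def]
  refine integral_congr_ae ?_
  filter_upwards [Lp.coeFn_star f] with x hx
  simp [hx, mul_comm]

theorem norm_star_L2 (f : L2 d) : ‖star f‖ = ‖f‖ := by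
  rw [Lp.norm_def, Lp.norm_def]
  congr 1
  refine eLpNorm_congr_norm_ae ?_
  filter_upwards [Lp.coeFn_star f] with x hx
  simp [hx]

theorem continuous_star_L2 : Continuous fun f : L2 d ↦ star f := by
  refine (Isometry.of_dist_eq fun f g ↦ ?_).continuous
  have h : star f - star g = star (f - g) := by
    refine Lp.ext ?_
    filter_upwards [Lp.coeFn_star f, Lp.coeFn_star g, Lp.coeFn_star (f - g), Lp.coeFn_sub f g,
      Lp.coeFn_sub (star f) (star g)] with x h1 h2 h3 h4 h5
    rw [h5, Pi.sub_apply, h1, h2, h3, Pi.star_apply, Pi.star_apply, Pi.star_apply, h4,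
      Pi.sub_apply, star_sub]
  rw [dist_eq_norm, dist_eq_norm, h, norm_star_L2]

theorem continuous_integral_mul : Continuous fun q : L2 d × L2 d ↦ ∫ x, q.1 x * q.2 x := by
  simp_rw [integral_mul_eq_inner]
  exact (continuous_star_L2.comp continuous_fst).inner continuous_snd

theorem integral_fourierInv_mul_schwartz (f : L2 d) (φ : 𝓢(Space d, ℂ)) :
    ∫ x, (𝓕⁻ f : L2 d) x * φ x = ∫ x, f x * (𝓕⁻ φ) x := by
  have h := congrArg (fun T ↦ T φ) (Lp.fourierInv_toTemperedDistribution_eq f)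
  simp only [Lp.toTemperedDistribution_apply, TemperedDistribution.fourierInv_apply,
    smul_eq_mul] at h
  simp_rw [mul_comm _ (φ _), ← h, mul_comm]

theorem integral_fourier_mul_schwartz (f : L2 d) (φ : 𝓢(Space d, ℂ)) :
    ∫ x, (𝓕 f : L2 d) x * φ x = ∫ x, f x * (𝓕 φ) x := by
  have h := congrArg (fun T ↦ T φ) (Lp.fourier_toTemperedDistribution_eq f)
  simp only [Lp.toTemperedDistribution_apply, TemperedDistribution.fourier_apply, smul_eq_mul] at h
  simp_rw [mul_comm _ (φ _), ← h, mul_comm]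

/-- The Fourier transform is symmetric for the bilinear pairing on `L²`. -/
theorem integral_fourier_mul (f g : L2 d) :
    ∫ x, (𝓕 f : L2 d) x * g x = ∫ x, f x * (𝓕 g : L2 d) x := by
  refine DenseRange.induction_on
    (p := fun g : L2 d ↦ ∫ x, (𝓕 f : L2 d) x * g x = ∫ x, f x * (𝓕 g : L2 d) x)
    (SchwartzMap.denseRange_toLpCLM (p := 2) ENNReal.ofNat_ne_top) g ?_ ?_
  · refine isClosed_eq ?_ ?_
    · exact continuous_integral_mul.comp (by fun_prop : Continuous fun g : L2 d ↦ ((𝓕 f : L2 d), g))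
    · exact continuous_integral_mul.comp
        (continuous_const.prodMk (FourierTransform.fourierCLM ℂ (L2 d)).continuous :
          Continuous fun g : L2 d ↦ (f, (𝓕 g : L2 d)))
  · intro φ
    have h := integral_fourier_mul_schwartz f φ
    simp only [SchwartzMap.toLpCLM_apply, SchwartzMap.toLp_fourier_eq]
    convert h using 1 <;> refine integral_congr_ae ?_
    · filter_upwards [φ.coeFn_toLp 2 volume] with x hx
      rw [hx]
    · filter_upwards [(𝓕 φ).coeFn_toLp 2 volume] with x hx
      rw [hx]

/-- Locally integrable functions that agree against all Schwartz functions are equal. -/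
theorem ae_eq_of_integral_mul_schwartz {f g : Space d → ℂ} (hf : LocallyIntegrable f)
    (hg : LocallyIntegrable g)
    (h : ∀ φ : 𝓢(Space d, ℂ), ∫ x, f x * φ x = ∫ x, g x * φ x) : f =ᵐ[volume] g := by
  refine ae_eq_of_integral_contDiff_smul_eq hf hg fun φ hφ hc ↦ ?_
  have h1 : ContDiff ℝ ((⊤ : ℕ∞) : WithTop ℕ∞) (fun x ↦ (φ x : ℂ)) :=
    Complex.ofRealCLM.contDiff.comp hφ
  have h2 : HasCompactSupport (fun x ↦ (φ x : ℂ)) := hc.comp_left Complex.ofReal_zero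
  simpa [mul_comm] using h (h2.toSchwartzMap h1)

/-- On `L¹ ∩ L²` the `L²` Fourier transform is the Fourier integral. -/
theorem coeFn_fourier_toLp {h : Space d → ℂ} (h1 : Integrable h) (h2 : MemLp h 2 volume) :
    (𝓕 (h2.toLp h) : L2 d) =ᵐ[volume] 𝓕 h := by
  refine ae_eq_of_integral_mul_schwartz ((Lp.memLp _).locallyIntegrable (by norm_num))
    (Continuous.locallyIntegrable
      (VectorFourier.fourierIntegral_continuous Real.continuous_fourierChar continuous_inner h1))
    fun φ ↦ ?_
  rw [integral_fourier_mul_schwartz]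
  have := VectorFourier.integral_fourierIntegral_smul_eq_flip (L := innerₗ (Space d))
    (μ := volume) (ν := volume) Real.continuous_fourierChar continuous_inner h1
    (φ.integrable (μ := volume))
  simp only [smul_eq_mul, flip_innerₗ] at this
  refine Eq.trans (integral_congr_ae ?_) this.symm
  filter_upwards [h2.coeFn_toLp] with x hx
  rw [hx]; rfl

theorem coeFn_fourierInv_toLp {h : Space d → ℂ} (h1 : Integrable h) (h2 : MemLp h 2 volume) :
    (𝓕⁻ (h2.toLp h) : L2 d) =ᵐ[volume] 𝓕⁻ h := by
  have hc : Continuous (𝓕⁻ h) := by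
    rw [Real.fourierInv_eq_fourier_comp_neg]
    exact VectorFourier.fourierIntegral_continuous Real.continuous_fourierChar continuous_inner
      h1.comp_neg
  refine ae_eq_of_integral_mul_schwartz ((Lp.memLp _).locallyIntegrable (by norm_num))
    hc.locallyIntegrable fun φ ↦ ?_
  rw [integral_fourierInv_mul_schwartz]
  have := VectorFourier.integral_fourierIntegral_smul_eq_flip (L := -innerₗ (Space d))
    (μ := volume) (ν := volume) Real.continuous_fourierChar continuous_inner.neg h1
    (φ.integrable (μ := volume))
  have hL : (-innerₗ (Space d)).flip = -innerₗ (Space d) := by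
    ext x y
    simp [real_inner_comm]
  rw [hL] at this
  simp only [smul_eq_mul] at this
  refine Eq.trans (integral_congr_ae ?_) this.symm
  filter_upwards [h2.coeFn_toLp] with x hx
  rw [hx, SchwartzMap.fourierInv_coe]; rfl

/-! ### The free group on `L²` -/

/-- Multiplication by the symbol of `U t`, on the Fourier side. -/
noncomputable def symbolMul (t : ℝ) (f : L2 d) : L2 d :=
  (memLp_freeSymbol_mul t f).toLp

theorem coeFn_symbolMul (t : ℝ) (f : L2 d) :
    symbolMul t f =ᵐ[volume] fun ξ ↦ freeSymbol t ξ * f ξ := MemLp.coeFn_toLp _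

theorem U_eq (t : ℝ) (f : L2 d) : U t f = 𝓕⁻ (symbolMul t (𝓕 f)) := rfl

theorem symbolMul_add (t : ℝ) (f g : L2 d) :
    symbolMul t (f + g) = symbolMul t f + symbolMul t g := by
  refine Lp.ext ?_
  filter_upwards [coeFn_symbolMul t f, coeFn_symbolMul t g, coeFn_symbolMul t (f + g),
    Lp.coeFn_add f g, Lp.coeFn_add (symbolMul t f) (symbolMul t g)] with x h1 h2 h3 h4 h5
  rw [h3, h4, h5, Pi.add_apply, Pi.add_apply, h1, h2, mul_add]

theorem symbolMul_smul (t : ℝ) (c : ℂ) (f : L2 d) :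
    symbolMul t (c • f) = c • symbolMul t f := by
  refine Lp.ext ?_
  filter_upwards [coeFn_symbolMul t f, coeFn_symbolMul t (c • f),
    Lp.coeFn_smul c f, Lp.coeFn_smul c (symbolMul t f)] with x h1 h3 h4 h5
  rw [h3, h4, h5, Pi.smul_apply, Pi.smul_apply, h1, smul_eq_mul, smul_eq_mul, mul_left_comm]

theorem inner_symbolMul (t : ℝ) (f g : L2 d) :
    inner ℂ (symbolMul t f) (symbolMul t g) = inner ℂ f g := by
  rw [L2.inner_def, L2.inner_def]
  refine integral_congr_ae ?_
  filter_upwards [coeFn_symbolMul t f, coeFn_symbolMul t g] with x h1 h2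
  rw [h1, h2]
  have h := Complex.mul_conj' (freeSymbol t x)
  rw [norm_freeSymbol] at h
  simp only [RCLike.inner_apply, map_mul]
  rw [Complex.ofReal_one, one_pow] at h
  linear_combination (g x * (starRingEnd ℂ) (f x)) * h

theorem U_add (t : ℝ) (f g : L2 d) : U t (f + g) = U t f + U t g := by
  simp_rw [U_eq, FourierTransform.fourier_add, symbolMul_add, FourierTransform.fourierInv_add]

theorem U_smul (t : ℝ) (c : ℂ) (f : L2 d) : U t (c • f) = c • U t f := by
  simp_rw [U_eq, FourierTransform.fourier_smul, symbolMul_smul, FourierTransform.fourierInv_smul]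

/-- `U t` as a linear map. -/
noncomputable def ULin (t : ℝ) : L2 d →ₗ[ℂ] L2 d where
  toFun := U t
  map_add' := U_add t
  map_smul' := U_smul t

theorem U_sum {ι : Type*} (s : Finset ι) (t : ℝ) (f : ι → L2 d) :
    U t (∑ i ∈ s, f i) = ∑ i ∈ s, U t (f i) := map_sum (ULin t) f s

theorem inner_fourierInv (f g : L2 d) : inner ℂ (𝓕⁻ f : L2 d) (𝓕⁻ g : L2 d) = inner ℂ f g := by
  rw [← Lp.inner_fourier_eq, FourierTransform.fourier_fourierInv_eq,
    FourierTransform.fourier_fourierInv_eq]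

theorem inner_U (t : ℝ) (f g : L2 d) : inner ℂ (U t f) (U t g) = inner ℂ f g := by
  rw [U_eq, U_eq, inner_fourierInv, inner_symbolMul, Lp.inner_fourier_eq]

theorem continuous_symbolMul (f : L2 d) : Continuous fun t : ℝ ↦ symbolMul t f := by
  rw [continuous_iff_continuousAt]
  intro t₀
  have hc : ∀ ξ : Space d, Continuous fun t : ℝ ↦ freeSymbol t ξ := fun ξ ↦ by
    unfold freeSymbol; fun_prop
  have hm : ∀ t : ℝ, Measurable (fun ξ ↦ ‖(freeSymbol t ξ - freeSymbol t₀ ξ) * f ξ‖ₑ ^ (2 : ℝ)) :=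
    fun t ↦
    ((((continuous_freeSymbol t).sub (continuous_freeSymbol t₀)).stronglyMeasurable.mul
      (Lp.stronglyMeasurable f)).enorm).pow_const _
  have h : Tendsto (fun t ↦ ∫⁻ ξ, ‖(freeSymbol t ξ - freeSymbol t₀ ξ) * f ξ‖ₑ ^ (2 : ℝ)) (𝓝 t₀)
      (𝓝 (∫⁻ _ : Space d, 0)) := by
    refine tendsto_lintegral_filter_of_dominated_convergence
      (fun ξ ↦ (2 * ‖f ξ‖ₑ) ^ (2 : ℝ)) ?_ ?_ ?_ ?_
    · filter_upwards with t
      exact hm t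
    · filter_upwards with t
      filter_upwards with ξ
      refine ENNReal.rpow_le_rpow ?_ (by norm_num)
      rw [enorm_mul]
      gcongr
      rw [← ofReal_norm]
      refine ENNReal.ofReal_le_of_le_toReal ?_
      refine (norm_sub_le _ _).trans ?_
      rw [norm_freeSymbol, norm_freeSymbol]
      norm_num
    · simp_rw [ENNReal.mul_rpow_of_nonneg _ _ (show (0 : ℝ) ≤ 2 by norm_num)]
      rw [lintegral_const_mul'' _ ((Lp.aestronglyMeasurable f).enorm.pow_const _)]
      refine ENNReal.mul_ne_top (by simp) ?_
      have := (Lp.memLp f).2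
      rw [eLpNorm_lt_top_iff_lintegral_rpow_enorm_lt_top (by norm_num) (by norm_num)] at this
      simpa using this.ne
    · filter_upwards with ξ
      have : Tendsto (fun t ↦ (freeSymbol t ξ - freeSymbol t₀ ξ) * f ξ) (𝓝 t₀) (𝓝 0) := by
        have h0 : Continuous fun t ↦ (freeSymbol t ξ - freeSymbol t₀ ξ) * f ξ :=
          ((hc ξ).sub continuous_const).mul continuous_const
        have := h0.tendsto t₀
        simp only [sub_self, zero_mul] at this
        exact this
      have h2 := (ENNReal.continuous_rpow_const (y := (2 : ℝ))).tendsto _ |>.comp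
        ((continuous_enorm.tendsto _).comp this)
      simp only [enorm_zero, ENNReal.zero_rpow_of_pos two_pos] at h2
      exact h2
  rw [lintegral_zero] at h
  unfold ContinuousAt
  rw [tendsto_iff_dist_tendsto_zero]
  have h2 := (ENNReal.continuous_rpow_const (y := (2 : ℝ)⁻¹)).tendsto _ |>.comp h
  have h3 := (ENNReal.tendsto_toReal (by simp)).comp h2
  refine (h3.congr fun t ↦ ?_).trans (by simp)
  rw [dist_eq_norm, Lp.norm_def, eLpNorm_eq_lintegral_rpow_enorm_toReal (by norm_num) (by norm_num)]
  simp only [Function.comp_apply, ENNReal.toReal_ofNat, one_div]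
  congr 2
  refine lintegral_congr_ae ?_
  filter_upwards [coeFn_symbolMul t f, coeFn_symbolMul t₀ f,
    Lp.coeFn_sub (symbolMul t f) (symbolMul t₀ f)] with x h1 h2 h3
  rw [h3, Pi.sub_apply, h1, h2, sub_mul]

/-- Strong continuity of the free group. -/
theorem continuous_U (f : L2 d) : Continuous fun t : ℝ ↦ U t f :=
  (FourierTransform.fourierInvCLM ℂ (L2 d)).continuous.comp (continuous_symbolMul (𝓕 f))

/-! ### The free evolution of Gaussians -/

/-- The Gaussian `exp (-b |ξ|² - 2πi y·ξ)` on the Fourier side. -/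
noncomputable def fourierGaussian (b : ℂ) (y ξ : Space d) : ℂ :=
  Complex.exp (-b * ‖ξ‖ ^ 2 + 2 * Real.pi * Complex.I * (inner ℝ (-y) ξ : ℝ))

theorem norm_fourierGaussian (b : ℂ) (y ξ : Space d) :
    ‖fourierGaussian b y ξ‖ = Real.exp (-b.re * ‖ξ‖ ^ 2) := by
  rw [fourierGaussian, Complex.norm_exp]
  congr 1
  simp [← Complex.ofReal_pow]

theorem continuous_fourierGaussian (b : ℂ) (y : Space d) :
    Continuous (fourierGaussian b y) := by
  unfold fourierGaussian; fun_prop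

theorem integrable_exp_neg_mul_sq {a : ℝ} (ha : 0 < a) :
    Integrable (fun x : Space d ↦ Real.exp (-a * ‖x‖ ^ 2)) := by
  have := (GaussianFourier.integrable_cexp_neg_mul_sq_norm_add (V := Space d) (b := (a : ℂ))
    (by simpa using ha) 0 0).norm
  refine this.congr (Eventually.of_forall fun x ↦ ?_)
  simp [Complex.norm_exp, ← Complex.ofReal_pow]

theorem integrable_fourierGaussian {b : ℂ} (hb : 0 < b.re) (y : Space d) :
    Integrable (fourierGaussian b y) :=
  (integrable_exp_neg_mul_sq hb).mono' (continuous_fourierGaussian b y).aestronglyMeasurable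
    (Eventually.of_forall fun ξ ↦ (norm_fourierGaussian b y ξ).le)

theorem memLp_fourierGaussian {b : ℂ} (hb : 0 < b.re) (y : Space d) :
    MemLp (fourierGaussian b y) 2 volume := by
  rw [memLp_two_iff_integrable_sq_norm (continuous_fourierGaussian b y).aestronglyMeasurable]
  refine (integrable_exp_neg_mul_sq (a := 2 * b.re) (by positivity)).congr
    (Eventually.of_forall fun ξ ↦ ?_)
  simp only [norm_fourierGaussian, ← Real.exp_nat_mul]
  congr 1
  push_cast; ring

theorem fourier_fourierGaussian {b : ℂ} (hb : 0 < b.re) (y w : Space d) :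
    𝓕 (fourierGaussian b y) w =
      (Real.pi / b) ^ (d / 2 : ℂ) * Complex.exp (-Real.pi ^ 2 * ‖w + y‖ ^ 2 / b) := by
  have := fourier_gaussian_innerProductSpace' hb (-y) w
  rw [finrank_euclideanSpace_fin] at this
  rw [show -y - w = -(w + y) by abel, norm_neg] at this
  exact this

theorem fourierInv_fourierGaussian {b : ℂ} (hb : 0 < b.re) (y w : Space d) :
    𝓕⁻ (fourierGaussian b y) w =
      (Real.pi / b) ^ (d / 2 : ℂ) * Complex.exp (-Real.pi ^ 2 * ‖w - y‖ ^ 2 / b) := by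
  rw [Real.fourierInv_eq_fourier_neg, fourier_fourierGaussian hb,
    show -w + y = -(w - y) by abel, norm_neg]

/-- The free evolution at time `t` of the Gaussian `exp (-a |x - y|²)`. -/
noncomputable def freeGaussian (a t : ℝ) (y x : Space d) : ℂ :=
  (1 / (1 + 2 * a * t * Complex.I)) ^ (d / 2 : ℂ) *
    Complex.exp (-(a / (1 + 2 * a * t * Complex.I)) * ‖x - y‖ ^ 2)

theorem freeGaussian_zero (a : ℝ) (y x : Space d) :
    freeGaussian a 0 y x = ((Real.exp (-a * ‖x - y‖ ^ 2) : ℝ) : ℂ) := by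
  simp [freeGaussian]

theorem symbolMul_fourierGaussian {b : ℂ} (hb : 0 < b.re) (y : Space d) (t : ℝ)
    (hb' : 0 < (b + 2 * Real.pi ^ 2 * t * Complex.I).re) :
    symbolMul t ((memLp_fourierGaussian hb y).toLp _) =
      (memLp_fourierGaussian hb' y).toLp _ := by
  refine Lp.ext ?_
  filter_upwards [coeFn_symbolMul t ((memLp_fourierGaussian hb y).toLp _),
    (memLp_fourierGaussian hb y).coeFn_toLp, (memLp_fourierGaussian hb' y).coeFn_toLp]
    with ξ h1 h2 h3
  rw [h1, h2, h3, freeSymbol, fourierGaussian, fourierGaussian, ← Complex.exp_add]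
  congr 1
  push_cast
  ring

theorem ofReal_mul_cpow {r : ℝ} (hr : 0 < r) {z : ℂ} (hz : z ≠ 0) (w : ℂ) :
    ((r : ℂ) * z) ^ w = (r : ℂ) ^ w * z ^ w := by
  have hr' : (r : ℂ) ≠ 0 := by exact_mod_cast hr.ne'
  rw [Complex.cpow_def_of_ne_zero (mul_ne_zero hr' hz), Complex.cpow_def_of_ne_zero hr',
    Complex.cpow_def_of_ne_zero hz, ← Complex.exp_add, Complex.log_ofReal_mul hr hz,
    Complex.ofReal_log hr.le, add_mul]

/-- The `d/2`-th powers in the Fourier inversion of an evolved Gaussian combine, without crossing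
the branch cut of the complex power: the bases differ by positive real factors. -/
theorem gaussian_prefactor {a : ℝ} (ha : 0 < a) (t : ℝ) :
    ((Real.pi / a : ℝ) : ℂ) ^ (d / 2 : ℂ) *
      (Real.pi / ((Real.pi ^ 2 / a : ℝ) + 2 * Real.pi ^ 2 * t * Complex.I)) ^ (d / 2 : ℂ) =
      (1 / (1 + 2 * a * t * Complex.I)) ^ (d / 2 : ℂ) := by
  have hpi := Real.pi_pos
  have hz : (1 + 2 * a * t * Complex.I : ℂ) ≠ 0 := fun h ↦ by
    have := congrArg Complex.re h
    simp at this
  have hpi' : (Real.pi : ℂ) ≠ 0 := by exact_mod_cast hpi.ne'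
  have ha' : (a : ℂ) ≠ 0 := by exact_mod_cast ha.ne'
  have h1 : (Real.pi / ((Real.pi ^ 2 / a : ℝ) + 2 * Real.pi ^ 2 * t * Complex.I) : ℂ) =
      ((a / Real.pi : ℝ) : ℂ) * (1 / (1 + 2 * a * t * Complex.I)) := by
    have : ((Real.pi ^ 2 / a : ℝ) + 2 * Real.pi ^ 2 * t * Complex.I : ℂ) =
        (Real.pi ^ 2 / a) * (1 + 2 * a * t * Complex.I) := by
      push_cast; field_simp
    rw [this]
    push_cast
    field_simp
  have hz' := one_div_ne_zero hz
  rw [h1, ofReal_mul_cpow (by positivity) hz', ← mul_assoc,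
    ← ofReal_mul_cpow (by positivity) (by simp [ha.ne', hpi.ne']), ← Complex.ofReal_mul,
    show Real.pi / a * (a / Real.pi) = 1 by field_simp, Complex.ofReal_one, Complex.one_cpow,
    one_mul]

/-- The exponent of an evolved Gaussian after Fourier inversion. -/
theorem gaussian_exponent {a : ℝ} (ha : 0 < a) (t : ℝ) (r : ℂ) :
    -(Real.pi : ℂ) ^ 2 * r / ((Real.pi ^ 2 / a : ℝ) + 2 * Real.pi ^ 2 * t * Complex.I) =
      -(a / (1 + 2 * a * t * Complex.I)) * r := by
  have hpi := Real.pi_pos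
  have hz : (1 + 2 * a * t * Complex.I : ℂ) ≠ 0 := fun h ↦ by
    have := congrArg Complex.re h
    simp at this
  have hpi' : (Real.pi : ℂ) ≠ 0 := by exact_mod_cast hpi.ne'
  have ha' : (a : ℂ) ≠ 0 := by exact_mod_cast ha.ne'
  have : ((Real.pi ^ 2 / a : ℝ) + 2 * Real.pi ^ 2 * t * Complex.I : ℂ) =
      (Real.pi ^ 2 / a) * (1 + 2 * a * t * Complex.I) := by
    push_cast; field_simp
  rw [this]
  field_simp

/-- The Gaussian `exp (-a |x - y|²)` as an element of `L²`. It is defined by Fourier inversion,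
which makes its free evolution explicit; `coeFn_gaussianL2` is the pointwise formula. -/
noncomputable def gaussianL2 {a : ℝ} (ha : 0 < a) (y : Space d) : L2 d :=
  ((Real.pi / a : ℝ) : ℂ) ^ (d / 2 : ℂ) •
    (𝓕⁻ ((memLp_fourierGaussian (b := ((Real.pi ^ 2 / a : ℝ) : ℂ))
      (Complex.ofReal_re _ ▸ by positivity) y).toLp _) : L2 d)

theorem re_evolved_pos {a : ℝ} (ha : 0 < a) (t : ℝ) :
    0 < (((Real.pi ^ 2 / a : ℝ) : ℂ) + 2 * Real.pi ^ 2 * t * Complex.I).re := by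
  have : (((Real.pi ^ 2 / a : ℝ) : ℂ) + 2 * Real.pi ^ 2 * t * Complex.I).re = Real.pi ^ 2 / a := by
    rw [show (((Real.pi ^ 2 / a : ℝ) : ℂ) + 2 * Real.pi ^ 2 * t * Complex.I) =
      ((Real.pi ^ 2 / a : ℝ) : ℂ) + ((2 * Real.pi ^ 2 * t : ℝ) : ℂ) * Complex.I by push_cast; ring]
    simp only [Complex.add_re, Complex.ofReal_re, Complex.re_ofReal_mul, Complex.I_re, mul_zero,
      add_zero]
  rw [this]
  positivity

theorem coeFn_U_gaussianL2 {a : ℝ} (ha : 0 < a) (y : Space d) (t : ℝ) :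
    U t (gaussianL2 ha y) =ᵐ[volume] freeGaussian a t y := by
  rw [gaussianL2, U_smul, U_eq, FourierTransform.fourier_fourierInv_eq,
    symbolMul_fourierGaussian (Complex.ofReal_re _ ▸ by positivity) y t (re_evolved_pos ha t)]
  filter_upwards [Lp.coeFn_smul (((Real.pi / a : ℝ) : ℂ) ^ (d / 2 : ℂ))
    (𝓕⁻ ((memLp_fourierGaussian (re_evolved_pos ha t) y).toLp _) : L2 d),
    coeFn_fourierInv_toLp (integrable_fourierGaussian (re_evolved_pos ha t) y)
      (memLp_fourierGaussian (re_evolved_pos ha t) y)] with x h1 h2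
  rw [h1, Pi.smul_apply, h2, fourierInv_fourierGaussian (re_evolved_pos ha t), smul_eq_mul,
    ← mul_assoc, gaussian_prefactor ha, gaussian_exponent ha]
  rfl

theorem symbolMul_zero (f : L2 d) : symbolMul 0 f = f := by
  refine Lp.ext ?_
  filter_upwards [coeFn_symbolMul 0 f] with x h1
  rw [h1]
  simp [freeSymbol]

theorem U_zero (f : L2 d) : U 0 f = f := by
  rw [U_eq, symbolMul_zero, FourierTransform.fourierInv_fourier_eq]

theorem coeFn_gaussianL2 {a : ℝ} (ha : 0 < a) (y : Space d) :
    gaussianL2 ha y =ᵐ[volume] fun x ↦ ((Real.exp (-a * ‖x - y‖ ^ 2) : ℝ) : ℂ) := by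
  have := coeFn_U_gaussianL2 ha y 0
  rw [U_zero] at this
  filter_upwards [this] with x hx
  rw [hx, freeGaussian_zero]

theorem toLp_schwartzGaussian {a : ℝ} (ha : 0 < a) :
    (schwartzGaussian d a ha).toLp 2 volume = gaussianL2 ha 0 := by
  refine Lp.ext ?_
  filter_upwards [(schwartzGaussian d a ha).coeFn_toLp 2 volume, coeFn_gaussianL2 ha (0 : Space d)]
    with x h1 h2
  rw [h1, h2, schwartzGaussian_apply, sub_zero]

/-- The free evolution is symmetric for the bilinear pairing; the case of a centred Gaussian is
enough here, and its evenness gives a short proof. -/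
theorem integral_U_mul_gaussianL2 {a : ℝ} (ha : 0 < a) (t : ℝ) (f : L2 d) :
    ∫ x, U t f x * gaussianL2 ha 0 x = ∫ x, f x * U t (gaussianL2 ha 0) x := by
  -- the Fourier transform and its inverse agree on even functions
  have hF : ∀ {b : ℂ} (hb : 0 < b.re),
      (𝓕 ((memLp_fourierGaussian hb (0 : Space d)).toLp _) : L2 d) =
        𝓕⁻ ((memLp_fourierGaussian hb (0 : Space d)).toLp _) := by
    intro b hb
    refine Lp.ext ?_
    filter_upwards [coeFn_fourier_toLp (integrable_fourierGaussian hb 0)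
      (memLp_fourierGaussian hb (0 : Space d)),
      coeFn_fourierInv_toLp (integrable_fourierGaussian hb 0)
      (memLp_fourierGaussian hb (0 : Space d))] with x h1 h2
    rw [h1, h2, fourier_fourierGaussian hb, fourierInv_fourierGaussian hb, add_zero, sub_zero]
  have hb : 0 < (((Real.pi ^ 2 / a : ℝ) : ℂ)).re := by
    rw [Complex.ofReal_re]; positivity
  set c : ℂ := ((Real.pi / a : ℝ) : ℂ) ^ (d / 2 : ℂ) with hc
  set H : L2 d := (memLp_fourierGaussian hb (0 : Space d)).toLp _ with hH
  have hg : gaussianL2 ha (0 : Space d) = c • (𝓕⁻ H : L2 d) := rfl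
  have hS : (𝓕 (symbolMul t H) : L2 d) = 𝓕⁻ (symbolMul t H) := by
    rw [hH, symbolMul_fourierGaussian hb 0 t (re_evolved_pos ha t), hF (re_evolved_pos ha t)]
  have hL : ∀ (v w : L2 d), ∫ x, v x * (c • w) x = c * ∫ x, v x * w x := by
    intro v w
    rw [← integral_const_mul]
    refine integral_congr_ae ?_
    filter_upwards [Lp.coeFn_smul c w] with x hx
    rw [hx, Pi.smul_apply, smul_eq_mul]; ring
  rw [hg, U_smul, hL, hL, U_eq t (𝓕⁻ H), FourierTransform.fourier_fourierInv_eq, ← hS,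
    ← integral_fourier_mul, ← hF hb, ← integral_fourier_mul, U_eq,
    FourierTransform.fourier_fourierInv_eq]
  congr 1
  refine integral_congr_ae ?_
  filter_upwards [coeFn_symbolMul t (𝓕 f), coeFn_symbolMul t H] with x h1 h2
  rw [h1, h2]; ring

/-! ### Pointwise bounds for evolved Gaussians -/

/-- The dependence of a Gaussian `exp (-w y)` on its complex coefficient `w` near `1`, with an error
that still decays in `y`. -/
theorem norm_exp_neg_mul_sub_le {w : ℂ} (hw : 1 / 2 ≤ w.re) {y : ℝ} (hy : 0 ≤ y) :
    ‖Complex.exp (-w * y) - Complex.exp (-y)‖ ≤ 4 * ‖w - 1‖ * Real.exp (-y / 4) := by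
  have hconv : Convex ℝ {z : ℂ | z.re ≤ -y / 2} := convex_halfSpace_re_le _
  have h := hconv.norm_image_sub_le_of_norm_hasDerivWithin_le (f := Complex.exp)
    (f' := Complex.exp) (C := Real.exp (-y / 2))
    (fun z _ ↦ (Complex.hasDerivAt_exp z).hasDerivWithinAt)
    (fun z hz ↦ by rw [Complex.norm_exp]; exact Real.exp_le_exp.mpr hz)
    (x := (-y : ℂ)) (y := -w * y) (by simp; linarith) (by simp; nlinarith)
  refine h.trans ?_
  rw [show -w * y - -(y : ℂ) = -((w - 1) * y) by ring, norm_neg, norm_mul, Complex.norm_real,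
    Real.norm_of_nonneg hy]
  have h1 : y * Real.exp (-y / 4) ≤ 4 := by
    have h2 : y / 4 ≤ Real.exp (y / 4) := (by linarith : y / 4 ≤ y / 4 + 1).trans
      (Real.add_one_le_exp _)
    have h3 : Real.exp (y / 4) * Real.exp (-y / 4) = 1 := by
      rw [← Real.exp_add]; simp [neg_div]
    nlinarith [Real.exp_pos (-y / 4)]
  have h4 : Real.exp (-y / 2) = Real.exp (-y / 4) * Real.exp (-y / 4) := by
    rw [← Real.exp_add]; congr 1; ring
  rw [h4]
  calc _ = ‖w - 1‖ * Real.exp (-y / 4) * (y * Real.exp (-y / 4)) := by ring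
    _ ≤ ‖w - 1‖ * Real.exp (-y / 4) * 4 := by gcongr
    _ = _ := by ring

theorem re_one_div_one_add (s : ℝ) :
    (1 / (1 + 2 * s * Complex.I) : ℂ).re = 1 / (1 + 4 * s ^ 2) := by
  rw [one_div, Complex.inv_re, Complex.normSq_apply]
  simp
  ring

theorem one_add_two_mul_I_ne_zero (s : ℝ) : (1 + 2 * s * Complex.I : ℂ) ≠ 0 := fun h ↦ by
  have := congrArg Complex.re h
  simp at this

/-- A Gaussian moves little during times that are short on its own parabolic scale, with an error
dominated by the Gaussian of twice the width. -/
theorem exists_norm_freeGaussian_sub_le (d : ℕ) {ε : ℝ} (hε : 0 < ε) :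
    ∃ δ > 0, ∀ a t : ℝ, 0 < a → 0 ≤ t → a * t ≤ δ → ∀ x : Space d,
      ‖freeGaussian a t 0 x - ((Real.exp (-a * ‖x‖ ^ 2) : ℝ) : ℂ)‖ ≤
        ε * Real.exp (-(a / 4) * ‖x‖ ^ 2) := by
  have hcont : ContinuousAt (fun s : ℝ ↦ ‖(1 / (1 + 2 * s * Complex.I) : ℂ) ^ (d / 2 : ℂ) - 1‖ +
      4 * ‖(1 / (1 + 2 * s * Complex.I) : ℂ) - 1‖) 0 := by
    have h1 : ContinuousAt (fun s : ℝ ↦ (1 / (1 + 2 * s * Complex.I) : ℂ)) 0 := by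
      refine ContinuousAt.div (by fun_prop) (by fun_prop) (one_add_two_mul_I_ne_zero 0)
    have h2 : ContinuousAt (fun s : ℝ ↦ (1 / (1 + 2 * s * Complex.I) : ℂ) ^ (d / 2 : ℂ)) 0 :=
      h1.cpow continuousAt_const (by simp)
    exact ((h2.sub continuousAt_const).norm).add (continuousAt_const.mul
      (h1.sub continuousAt_const).norm)
  obtain ⟨δ, hδ, h⟩ := Metric.continuousAt_iff.mp hcont ε hε
  refine ⟨min (δ / 2) (1 / 2), by positivity, fun a t ha ht hat x ↦ ?_⟩
  set s : ℝ := a * t with hs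
  have hs0 : 0 ≤ s := by positivity
  have hs1 : s ≤ δ / 2 := hat.trans (min_le_left _ _)
  have hs2 : s ≤ 1 / 2 := hat.trans (min_le_right _ _)
  set w : ℂ := 1 / (1 + 2 * s * Complex.I) with hw
  have hre : 1 / 2 ≤ w.re := by
    rw [hw, re_one_div_one_add, div_le_div_iff₀ (by norm_num) (by positivity)]
    nlinarith
  have hsum : ‖w ^ (d / 2 : ℂ) - 1‖ + 4 * ‖w - 1‖ ≤ ε := by
    have := h (x := s) (by rw [Real.dist_eq, sub_zero, abs_of_nonneg hs0]; linarith)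
    rw [Real.dist_eq] at this
    simp only [Complex.ofReal_zero, mul_zero, zero_mul, add_zero, div_one, Complex.one_cpow,
      sub_self, norm_zero, sub_zero] at this
    exact (le_abs_self _).trans this.le
  set y : ℝ := a * ‖x‖ ^ 2 with hy
  have hy0 : 0 ≤ y := by positivity
  have hfree : freeGaussian a t 0 x = w ^ (d / 2 : ℂ) * Complex.exp (-w * y) := by
    rw [freeGaussian, hw, hs, hy, sub_zero]
    push_cast
    congr 2
    · ring_nf
    · ring
  have hexp : Real.exp (-(a / 4) * ‖x‖ ^ 2) = Real.exp (-y / 4) := by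
    congr 1; rw [hy]; ring
  have hexp' : ((Real.exp (-a * ‖x‖ ^ 2) : ℝ) : ℂ) = Complex.exp (-y) := by
    rw [hy]; push_cast; congr 1; ring
  rw [hfree, hexp, hexp']
  have h1 : ‖Complex.exp (-w * y)‖ ≤ Real.exp (-y / 4) := by
    rw [Complex.norm_exp]
    refine Real.exp_le_exp.mpr ?_
    simp only [Complex.mul_re, Complex.neg_re, Complex.ofReal_re, Complex.ofReal_im, mul_zero,
      sub_zero]
    nlinarith
  calc ‖w ^ (d / 2 : ℂ) * Complex.exp (-w * y) - Complex.exp (-y)‖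
      = ‖(w ^ (d / 2 : ℂ) - 1) * Complex.exp (-w * y) +
          (Complex.exp (-w * y) - Complex.exp (-y))‖ := by congr 1; ring
    _ ≤ ‖w ^ (d / 2 : ℂ) - 1‖ * Real.exp (-y / 4) + 4 * ‖w - 1‖ * Real.exp (-y / 4) := by
      refine (norm_add_le _ _).trans (add_le_add ?_ (norm_exp_neg_mul_sub_le hre hy0))
      rw [norm_mul]
      gcongr
    _ = (‖w ^ (d / 2 : ℂ) - 1‖ + 4 * ‖w - 1‖) * Real.exp (-y / 4) := by ring
    _ ≤ _ := by gcongr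

/-- Dispersion of the unit Gaussian: at times comparable to `ρ` it has height `ρ^{-d/2}` and
width `ρ`. The constant `34` comes from `1 + 4 t² ≤ 17 ρ²` and `|x - y|² ≥ |x|² / 2 - |y|²`. -/
theorem norm_freeGaussian_le (y : Space d) {ρ t : ℝ} (hρ : 1 ≤ ρ) (ht : ρ ≤ t) (ht' : t ≤ 2 * ρ)
    (x : Space d) :
    ‖freeGaussian 1 t y x‖ ≤
      Real.exp (‖y‖ ^ 2) * ρ ^ (-(d / 2 : ℝ)) * Real.exp (-(34 * ρ ^ 2)⁻¹ * ‖x‖ ^ 2) := by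
  have hρ0 : 0 < ρ := by linarith
  set w : ℂ := 1 / (1 + 2 * t * Complex.I) with hw
  have hw0 : w ≠ 0 := one_div_ne_zero (one_add_two_mul_I_ne_zero t)
  have hfree : freeGaussian 1 t y x = w ^ (((d / 2 : ℝ)) : ℂ) *
      Complex.exp (-w * ((‖x - y‖ ^ 2 : ℝ) : ℂ)) := by
    rw [freeGaussian, hw]
    push_cast
    simp
  have hwn : ‖w‖ ≤ ρ⁻¹ := by
    rw [hw, norm_div, norm_one, one_div]
    refine inv_anti₀ hρ0 ?_
    have := Complex.abs_im_le_norm (1 + 2 * t * Complex.I)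
    have h2 : (1 + 2 * t * Complex.I : ℂ).im = 2 * t := by simp
    rw [h2] at this
    linarith [le_abs_self (2 * t)]
  have hre : (17 * ρ ^ 2)⁻¹ ≤ w.re := by
    rw [hw, re_one_div_one_add, one_div]
    refine inv_anti₀ (by positivity) ?_
    nlinarith
  rw [hfree, norm_mul, mul_comm (Real.exp _), mul_assoc]
  refine mul_le_mul ?_ ?_ (norm_nonneg _) (by positivity)
  · rw [Complex.norm_cpow_real, Real.rpow_neg hρ0.le, ← Real.inv_rpow hρ0.le]
    exact Real.rpow_le_rpow (norm_nonneg _) hwn (by positivity)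
  · rw [Complex.norm_exp, ← Real.exp_add, Real.exp_le_exp]
    have h1 : (-w * ((‖x - y‖ ^ 2 : ℝ) : ℂ)).re = -(w.re * ‖x - y‖ ^ 2) := by
      rw [Complex.re_mul_ofReal]; simp
    rw [h1]
    have h2 : ‖x‖ ^ 2 / 2 - ‖y‖ ^ 2 ≤ ‖x - y‖ ^ 2 := by
      have h3 : ‖x‖ ≤ ‖x - y‖ + ‖y‖ := by simpa using norm_add_le (x - y) y
      nlinarith [norm_nonneg x, norm_nonneg y, norm_nonneg (x - y), sq_nonneg (‖x - y‖ - ‖y‖)]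
    have h4 : (17 * ρ ^ 2)⁻¹ * ‖x - y‖ ^ 2 ≤ w.re * ‖x - y‖ ^ 2 := by gcongr
    have h5 : (17 * ρ ^ 2)⁻¹ * (‖x‖ ^ 2 / 2 - ‖y‖ ^ 2) ≤ (17 * ρ ^ 2)⁻¹ * ‖x - y‖ ^ 2 := by
      gcongr
    have h6 : (17 * ρ ^ 2)⁻¹ * ‖y‖ ^ 2 ≤ ‖y‖ ^ 2 := by
      refine mul_le_of_le_one_left (by positivity) (inv_le_one_of_one_le₀ ?_)
      nlinarith
    have h7 : (34 * ρ ^ 2)⁻¹ = (17 * ρ ^ 2)⁻¹ / 2 := by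
      field_simp; norm_num
    rw [h7]
    linarith

/-! ### Multiscale Gaussian weights -/

/-- The inverse square width `4⁻ᵏ R⁻²` at dyadic scale `2ᵏ R`. -/
noncomputable def scaleCoeff (R : ℝ) (k : ℕ) : ℝ := (4 ^ k * R ^ 2)⁻¹

theorem scaleCoeff_pos {R : ℝ} (hR : 0 < R) (k : ℕ) : 0 < scaleCoeff R k := by
  unfold scaleCoeff; positivity

theorem scaleCoeff_succ (R : ℝ) (k : ℕ) : scaleCoeff R (k + 1) = scaleCoeff R k / 4 := by
  unfold scaleCoeff
  rw [pow_succ, show (4 : ℝ) ^ k * 4 * R ^ 2 = 4 ^ k * R ^ 2 * 4 by ring, mul_inv, div_eq_mul_inv]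

/-- The Gaussian of width `2ᵏ R`. -/
noncomputable def scaleGaussian (d : ℕ) (R : ℝ) (k : ℕ) (x : Space d) : ℝ :=
  Real.exp (-scaleCoeff R k * ‖x‖ ^ 2)

/-- The ratio `2^{-(d+1)}` of the weights of consecutive scales: the integrals of the summands of
the multiscale weight then decay like `2^{-k}`. -/
noncomputable def scaleRatio (d : ℕ) : ℝ := (2 ^ (d + 1))⁻¹

theorem scaleRatio_pos (d : ℕ) : 0 < scaleRatio d := by unfold scaleRatio; positivity

/-- The multiscale weight `∑_{k ≤ n} 2^{-(d+1)k} exp (-|x|² / (2ᵏ R)²)`. A single Gaussian does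
not control the error of its free evolution, but each summand is controlled by the next one. -/
noncomputable def weight (d n : ℕ) (R : ℝ) (x : Space d) : ℝ :=
  ∑ k ∈ Finset.range (n + 1), scaleRatio d ^ k * scaleGaussian d R k x

theorem continuous_scaleGaussian (R : ℝ) (k : ℕ) : Continuous (scaleGaussian d R k) := by
  unfold scaleGaussian; fun_prop

theorem continuous_weight (n : ℕ) (R : ℝ) : Continuous (weight d n R) := by
  unfold weight
  exact continuous_finsetSum _ fun k _ ↦ continuous_const.mul (continuous_scaleGaussian R k)

theorem scaleGaussian_pos (R : ℝ) (k : ℕ) (x : Space d) : 0 < scaleGaussian d R k x :=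
  Real.exp_pos _

theorem scaleGaussian_le_one {R : ℝ} (hR : 0 < R) (k : ℕ) (x : Space d) :
    scaleGaussian d R k x ≤ 1 := by
  unfold scaleGaussian
  rw [Real.exp_le_one_iff]
  nlinarith [mul_nonneg (scaleCoeff_pos hR k).le (sq_nonneg ‖x‖)]

theorem weight_nonneg (n : ℕ) (R : ℝ) (x : Space d) : 0 ≤ weight d n R x :=
  Finset.sum_nonneg fun k _ ↦
    mul_nonneg (pow_nonneg (scaleRatio_pos d).le _) (scaleGaussian_pos R k x).le

theorem weight_succ (n : ℕ) (R : ℝ) (x : Space d) :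
    weight d (n + 1) R x =
      weight d n R x + scaleRatio d ^ (n + 1) * scaleGaussian d R (n + 1) x := by
  rw [weight, Finset.sum_range_succ]; rfl

theorem scaleGaussian_zero_le_weight (n : ℕ) (R : ℝ) (x : Space d) :
    scaleGaussian d R 0 x ≤ weight d n R x := by
  unfold weight
  refine le_trans (by simp) (Finset.single_le_sum (f := fun k ↦ scaleRatio d ^ k *
    scaleGaussian d R k x) (fun k _ ↦ mul_nonneg (pow_nonneg (scaleRatio_pos d).le _)
    (scaleGaussian_pos R k x).le) (Finset.mem_range.mpr n.succ_pos))

theorem weight_le_succ (n : ℕ) (R : ℝ) (x : Space d) : weight d n R x ≤ weight d (n + 1) R x := by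
  rw [weight_succ]
  have := mul_nonneg (pow_nonneg (scaleRatio_pos d).le (n + 1)) (scaleGaussian_pos R (n + 1) x).le
  linarith

theorem integrable_scaleGaussian {R : ℝ} (hR : 0 < R) (k : ℕ) :
    Integrable (scaleGaussian d R k) := integrable_exp_neg_mul_sq (scaleCoeff_pos hR k)

theorem integral_scaleGaussian {R : ℝ} (hR : 0 < R) (k : ℕ) :
    ∫ x, scaleGaussian d R k x = Real.pi ^ (d / 2 : ℝ) * R ^ d * (2 ^ d) ^ k := by
  have h := GaussianFourier.integral_rexp_neg_mul_sq_norm (V := Space d) (scaleCoeff_pos hR k)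
  rw [finrank_euclideanSpace_fin] at h
  unfold scaleGaussian
  rw [h]
  have h1 : Real.pi / scaleCoeff R k = Real.pi * (2 ^ k * R) ^ (2 : ℝ) := by
    unfold scaleCoeff
    rw [Real.rpow_two, div_inv_eq_mul, mul_pow, ← pow_mul, mul_comm k, pow_mul]
    norm_num
  rw [h1, Real.mul_rpow Real.pi_pos.le (by positivity), ← Real.rpow_mul (by positivity),
    show (2 : ℝ) * (d / 2) = d by ring, Real.rpow_natCast, mul_pow, ← pow_mul, ← pow_mul,
    mul_comm k]
  ring

theorem integrable_weight {R : ℝ} (hR : 0 < R) (n : ℕ) : Integrable (weight d n R) := by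
  unfold weight
  exact integrable_finsetSum _ fun k _ ↦ (integrable_scaleGaussian hR k).const_mul _

theorem sum_geometric_two_le' (n : ℕ) : ∑ k ∈ Finset.range n, ((2 : ℝ)⁻¹) ^ k ≤ 2 := by
  have := sum_geometric_two_le n
  simpa [one_div] using this

theorem integral_weight_le {R : ℝ} (hR : 0 < R) (n : ℕ) :
    ∫ x, weight d n R x ≤ 2 * Real.pi ^ (d / 2 : ℝ) * R ^ d := by
  unfold weight
  rw [integral_finsetSum _ fun k _ ↦ (integrable_scaleGaussian hR k).const_mul _]
  simp_rw [integral_const_mul, integral_scaleGaussian hR]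
  have h : ∀ k, scaleRatio d ^ k * (Real.pi ^ (d / 2 : ℝ) * R ^ d * (2 ^ d) ^ k) =
      (2 : ℝ)⁻¹ ^ k * (Real.pi ^ (d / 2 : ℝ) * R ^ d) := by
    intro k
    have : (2 : ℝ)⁻¹ = scaleRatio d * 2 ^ d := by
      unfold scaleRatio; rw [pow_succ]; field_simp
    rw [this, mul_pow]; ring
  simp_rw [h, ← Finset.sum_mul]
  have := sum_geometric_two_le' (n + 1)
  calc _ ≤ 2 * (Real.pi ^ (d / 2 : ℝ) * R ^ d) := by gcongr
    _ = _ := by ring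

/-- The multiscale weight as a Schwartz function. -/
noncomputable def weightSchwartz (d n : ℕ) {R : ℝ} (hR : 0 < R) : 𝓢(Space d, ℂ) :=
  ∑ k ∈ Finset.range (n + 1),
    ((scaleRatio d ^ k : ℝ) : ℂ) • schwartzGaussian d (scaleCoeff R k) (scaleCoeff_pos hR k)

theorem weightSchwartz_apply (n : ℕ) {R : ℝ} (hR : 0 < R) (x : Space d) :
    weightSchwartz d n hR x = (weight d n R x : ℂ) := by
  simp [weightSchwartz, weight, scaleGaussian]

theorem toLp_weightSchwartz (n : ℕ) {R : ℝ} (hR : 0 < R) :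
    (weightSchwartz d n hR).toLp 2 volume =
      ∑ k ∈ Finset.range (n + 1), ((scaleRatio d ^ k : ℝ) : ℂ) •
        gaussianL2 (scaleCoeff_pos hR k) (0 : Space d) := by
  rw [← SchwartzMap.toLpCLM_apply (𝕜 := ℂ), weightSchwartz, map_sum]
  refine Finset.sum_congr rfl fun k _ ↦ ?_
  rw [map_smul, SchwartzMap.toLpCLM_apply, toLp_schwartzGaussian]

theorem integral_U_mul_weight (n : ℕ) {R : ℝ} (hR : 0 < R) (t : ℝ) (f : L2 d) :
    ∫ x, U t f x * weightSchwartz d n hR x =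
      ∫ x, f x * U t ((weightSchwartz d n hR).toLp 2 volume) x := by
  have h1 : ∫ x, U t f x * weightSchwartz d n hR x =
      ∫ x, U t f x * ((weightSchwartz d n hR).toLp 2 volume) x := by
    refine integral_congr_ae ?_
    filter_upwards [(weightSchwartz d n hR).coeFn_toLp 2 volume] with x hx
    rw [hx]
  rw [h1, toLp_weightSchwartz, U_sum, integral_mul_eq_inner, integral_mul_eq_inner, inner_sum,
    inner_sum]
  refine Finset.sum_congr rfl fun k _ ↦ ?_
  rw [U_smul, inner_smul_right, inner_smul_right, ← integral_mul_eq_inner,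
    ← integral_mul_eq_inner, integral_U_mul_gaussianL2]

theorem coeFn_finsetSum_L2 {ι : Type*} (s : Finset ι) (f : ι → L2 d) :
    (∑ i ∈ s, f i : L2 d) =ᵐ[volume] fun x ↦ ∑ i ∈ s, f i x := by
  classical
  induction s using Finset.induction_on with
  | empty =>
    exact Eventually.of_forall fun x ↦ by simp
  | insert i s hi ih =>
    rw [Finset.sum_insert hi]
    filter_upwards [ih, Lp.coeFn_add (f i) (∑ i ∈ s, f i)] with x h1 h2
    rw [h2, Pi.add_apply, h1, Finset.sum_insert hi]

theorem coeFn_U_weight (n : ℕ) {R : ℝ} (hR : 0 < R) (t : ℝ) :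
    U t ((weightSchwartz d n hR).toLp 2 volume) =ᵐ[volume] fun x ↦
      ∑ k ∈ Finset.range (n + 1),
        ((scaleRatio d ^ k : ℝ) : ℂ) * freeGaussian (scaleCoeff R k) t 0 x := by
  rw [toLp_weightSchwartz, U_sum]
  have h : ∀ k, U t (((scaleRatio d ^ k : ℝ) : ℂ) • gaussianL2 (scaleCoeff_pos hR k)
      (0 : Space d)) =ᵐ[volume] fun x ↦
        ((scaleRatio d ^ k : ℝ) : ℂ) * freeGaussian (scaleCoeff R k) t 0 x := by
    intro k
    rw [U_smul]
    filter_upwards [Lp.coeFn_smul ((scaleRatio d ^ k : ℝ) : ℂ)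
      (U t (gaussianL2 (scaleCoeff_pos hR k) (0 : Space d))),
      coeFn_U_gaussianL2 (scaleCoeff_pos hR k) (0 : Space d) t] with x h1 h2
    rw [h1, Pi.smul_apply, h2, smul_eq_mul]
  filter_upwards [coeFn_finsetSum_L2 (Finset.range (n + 1)) (fun k ↦
    U t (((scaleRatio d ^ k : ℝ) : ℂ) • gaussianL2 (scaleCoeff_pos hR k) (0 : Space d))),
    ae_all_iff.mpr h] with x h1 h2
  rw [h1]
  exact Finset.sum_congr rfl fun k _ ↦ h2 k

/-- During times short compared to `R²` the free evolution of the multiscale weight stays close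
to the weight, relative to the weight with one more scale. -/
theorem exists_norm_U_weight_sub_le (d : ℕ) {ε : ℝ} (hε : 0 < ε) :
    ∃ δ > 0, ∀ (n : ℕ) (R : ℝ) (hR : 0 < R) (t : ℝ), 0 ≤ t → t ≤ δ * R ^ 2 →
      ∀ᵐ x : Space d, ‖U t ((weightSchwartz d n hR).toLp 2 volume) x - (weight d n R x : ℂ)‖ ≤
        ε * weight d (n + 1) R x := by
  obtain ⟨δ, hδ, h⟩ := exists_norm_freeGaussian_sub_le d
    (mul_pos hε (scaleRatio_pos d))
  refine ⟨δ, hδ, fun n R hR t ht htR ↦ ?_⟩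
  filter_upwards [coeFn_U_weight n hR t] with x hx
  rw [hx, weight, Complex.ofReal_sum, ← Finset.sum_sub_distrib]
  refine (norm_sum_le _ _).trans ?_
  have hk : ∀ k, ‖((scaleRatio d ^ k : ℝ) : ℂ) * freeGaussian (scaleCoeff R k) t 0 x -
      ((scaleRatio d ^ k * scaleGaussian d R k x : ℝ) : ℂ)‖ ≤
        ε * (scaleRatio d ^ (k + 1) * scaleGaussian d R (k + 1) x) := by
    intro k
    have ha := scaleCoeff_pos hR k
    have hle : scaleCoeff R k * t ≤ δ := by
      have h1 : scaleCoeff R k ≤ (R ^ 2)⁻¹ := by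
        unfold scaleCoeff
        refine inv_anti₀ (by positivity) ?_
        exact le_mul_of_one_le_left (by positivity) (one_le_pow₀ (by norm_num))
      calc _ ≤ (R ^ 2)⁻¹ * (δ * R ^ 2) := by gcongr
        _ = δ := by field_simp
    have h2 := h _ t ha ht hle x
    rw [Complex.ofReal_mul, ← mul_sub, norm_mul, Complex.norm_real,
      Real.norm_of_nonneg (pow_nonneg (scaleRatio_pos d).le k)]
    calc _ ≤ scaleRatio d ^ k * (ε * scaleRatio d * Real.exp (-(scaleCoeff R k / 4) * ‖x‖ ^ 2)) :=
          mul_le_mul_of_nonneg_left h2 (pow_nonneg (scaleRatio_pos d).le k)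
      _ = _ := by rw [scaleGaussian, scaleCoeff_succ]; ring
  refine (Finset.sum_le_sum fun k _ ↦ hk k).trans ?_
  rw [← Finset.mul_sum, weight, Finset.sum_range_succ' _ (n + 1)]
  gcongr
  have := mul_nonneg (pow_nonneg (scaleRatio_pos d).le 0) (scaleGaussian_pos R 0 x).le
  linarith

/-! ### The nonlinearity -/

theorem LipschitzType.exists_bounds {p : ℝ} (hp : 1 < p) {F : ℂ → ℂ} (hF : LipschitzType p F) :
    ∃ C : ℝ, 0 < C ∧ (∀ z w : ℂ, ‖F z - F w‖ ≤ C * (‖z‖ + ‖w‖) ^ (p - 1) * ‖z - w‖) ∧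
      ∀ z, ‖F z‖ ≤ C * ‖z‖ ^ p := by
  obtain ⟨h0, C, hC, h⟩ := hF
  refine ⟨C, hC, h, fun z ↦ ?_⟩
  have := h z 0
  rw [h0, sub_zero, norm_zero, add_zero, sub_zero] at this
  refine this.trans_eq ?_
  rcases eq_or_ne ‖z‖ 0 with hz | hz
  · rw [hz, Real.zero_rpow (show p ≠ 0 by linarith), mul_zero, mul_zero]
  · rw [mul_assoc, ← Real.rpow_add_one hz, sub_add_cancel]

theorem LipschitzType.continuous {p : ℝ} (hp : 1 < p) {F : ℂ → ℂ} (hF : LipschitzType p F) :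
    Continuous F := by
  obtain ⟨C, hC, h, -⟩ := hF.exists_bounds hp
  rw [continuous_iff_continuousAt]
  intro w
  unfold ContinuousAt
  rw [tendsto_iff_norm_sub_tendsto_zero]
  have h1 : Continuous fun z : ℂ ↦ C * (‖z‖ + ‖w‖) ^ (p - 1) * ‖z - w‖ := by
    refine (continuous_const.mul ?_).mul (by fun_prop)
    exact (by fun_prop : Continuous fun z : ℂ ↦ ‖z‖ + ‖w‖).rpow_const
      fun _ ↦ Or.inr (by linarith)
  have h2 := h1.tendsto w
  simp only [sub_self, norm_zero, mul_zero] at h2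
  exact squeeze_zero (fun _ ↦ norm_nonneg _) (fun z ↦ h z w) h2

/-- The truncation of `ℂ` to the square of half side `m`, coordinate by coordinate. -/
noncomputable def clamp (m : ℝ) (z : ℂ) : ℂ := ⟨max (-m) (min m z.re), max (-m) (min m z.im)⟩

theorem norm_clamp_sub_le (m : ℝ) (z w : ℂ) : ‖clamp m z - clamp m w‖ ≤ 2 * ‖z - w‖ := by
  have h : ∀ a b : ℝ, |max (-m) (min m a) - max (-m) (min m b)| ≤ |a - b| := fun a b ↦
    calc _ ≤ max |-m - -m| |min m a - min m b| := abs_max_sub_max_le_max _ _ _ _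
      _ ≤ max |-m - -m| (max |m - m| |a - b|) := by gcongr; exact abs_min_sub_min_le_max _ _ _ _
      _ = |a - b| := by simp
  refine (Complex.norm_le_abs_re_add_abs_im _).trans ?_
  have h1 := h z.re w.re
  have h2 := h z.im w.im
  have h3 := Complex.abs_re_le_norm (z - w)
  have h4 := Complex.abs_im_le_norm (z - w)
  simp only [clamp, Complex.sub_re, Complex.sub_im] at *
  linarith

theorem clamp_zero {m : ℝ} (hm : 0 ≤ m) : clamp m 0 = 0 := by
  apply Complex.ext <;> simp [clamp, hm]

theorem norm_clamp_le {m : ℝ} (hm : 0 ≤ m) (z : ℂ) : ‖clamp m z‖ ≤ 2 * ‖z‖ := by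
  simpa [clamp_zero hm] using norm_clamp_sub_le m z 0

theorem norm_clamp_le' {m : ℝ} (hm : 0 ≤ m) (z : ℂ) : ‖clamp m z‖ ≤ 2 * m := by
  refine (Complex.norm_le_abs_re_add_abs_im _).trans ?_
  have h : ∀ a : ℝ, |max (-m) (min m a)| ≤ m := fun a ↦
    abs_le.mpr ⟨le_max_left _ _, max_le (by linarith) (min_le_left _ _)⟩
  have h1 := h z.re
  have h2 := h z.im
  simp only [clamp]
  linarith

theorem clamp_eq {m : ℝ} {z : ℂ} (h : ‖z‖ ≤ m) : clamp m z = z := by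
  have h1 := abs_le.mp ((Complex.abs_re_le_norm z).trans h)
  have h2 := abs_le.mp ((Complex.abs_im_le_norm z).trans h)
  apply Complex.ext <;> simp [clamp, h1, h2]

theorem LipschitzType.lipschitzWith_clamp {p : ℝ} (hp : 1 < p) {F : ℂ → ℂ}
    (hF : LipschitzType p F) {m : ℝ} (hm : 0 ≤ m) :
    ∃ K : NNReal, LipschitzWith K (fun z ↦ F (clamp m z)) := by
  obtain ⟨C, hC, h, -⟩ := hF.exists_bounds hp
  refine ⟨Real.toNNReal (C * (4 * m) ^ (p - 1) * 2), LipschitzWith.of_dist_le_mul fun z w ↦ ?_⟩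
  rw [dist_eq_norm, dist_eq_norm, Real.coe_toNNReal _ (by positivity)]
  have h1 := norm_clamp_le' hm z
  have h2 := norm_clamp_le' hm w
  calc _ ≤ C * (‖clamp m z‖ + ‖clamp m w‖) ^ (p - 1) * ‖clamp m z - clamp m w‖ := h _ _
    _ ≤ C * (4 * m) ^ (p - 1) * (2 * ‖z - w‖) := by
      gcongr
      · linarith
      · exact norm_clamp_sub_le m z w
    _ = _ := by ring

/-- The pairing `∫ F(v) w` of a nonlinear function of `v ∈ C(ℝ; L²)` with `w ∈ C(ℝ; L²)` is a
measurable function of time wherever it converges absolutely, although `F(v)` need not be in `L²`: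
it is a limit of continuous functions, obtained by truncating the argument of `F`. -/
theorem aestronglyMeasurable_integral_nonlinear {p : ℝ} (hp : 1 < p) {F : ℂ → ℂ}
    (hF : LipschitzType p F) {v w : ℝ → L2 d} (hv : Continuous v) (hw : Continuous w)
    {μ : Measure ℝ}
    (hfin : ∀ᵐ s ∂μ, Integrable fun x ↦ ‖v s x‖ ^ p * ‖w s x‖) :
    AEStronglyMeasurable (fun s ↦ ∫ x, F (v s x) * w s x) μ := by
  obtain ⟨C, hC, -, hb⟩ := hF.exists_bounds hp
  have hFc := hF.continuous hp
  have hmeas : ∀ m : ℕ, Continuous fun s ↦ ∫ x, F (clamp m (v s x)) * w s x := by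
    intro m
    obtain ⟨K, hK⟩ := hF.lipschitzWith_clamp hp (Nat.cast_nonneg m)
    have h0 : F (clamp m 0) = 0 := by rw [clamp_zero (Nat.cast_nonneg m), hF.1]
    have h1 : Continuous fun s ↦ (hK.compLp h0 (v s), w s) :=
      ((hK.continuous_compLp h0).comp hv).prodMk hw
    refine (continuous_integral_mul.comp h1).congr fun s ↦ integral_congr_ae ?_
    filter_upwards [hK.coeFn_compLp h0 (v s)] with x hx
    rw [hx]; rfl
  refine aestronglyMeasurable_of_tendsto_ae atTop (fun m : ℕ ↦ (hmeas m).aestronglyMeasurable) ?_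
  filter_upwards [hfin] with s hs
  refine tendsto_integral_of_dominated_convergence (fun x ↦ C * 2 ^ p * (‖v s x‖ ^ p * ‖w s x‖))
    (fun m ↦ ?_) (hs.const_mul _) (fun m ↦ ?_) ?_
  · obtain ⟨K, hK⟩ := hF.lipschitzWith_clamp hp (Nat.cast_nonneg m)
    exact (hK.continuous.comp_aestronglyMeasurable (Lp.aestronglyMeasurable (v s))).mul
      (Lp.aestronglyMeasurable (w s))
  · refine Eventually.of_forall fun x ↦ ?_
    rw [norm_mul]
    calc ‖F (clamp m (v s x))‖ * ‖w s x‖ ≤ C * ‖clamp m (v s x)‖ ^ p * ‖w s x‖ := by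
          gcongr; exact hb _
      _ ≤ C * (2 * ‖v s x‖) ^ p * ‖w s x‖ := by
          gcongr; exact norm_clamp_le (Nat.cast_nonneg m) _
      _ = _ := by rw [Real.mul_rpow (by norm_num) (norm_nonneg _)]; ring
  · refine Eventually.of_forall fun x ↦ tendsto_const_nhds.congr' ?_
    filter_upwards [eventually_ge_atTop ⌈‖v s x‖⌉₊] with m hm
    rw [clamp_eq ((Nat.le_ceil _).trans (by exact_mod_cast hm))]

/-! ### Weighted powers of `L²` functions -/

/-- The weighted integral `∫ |f|^p w`, with values in `[0, ∞]`. -/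
noncomputable def weightedPow (p : ℝ) (w : Space d → ℝ) (f : L2 d) : ℝ≥0∞ :=
  ∫⁻ x, ‖f x‖ₑ ^ p * ENNReal.ofReal (w x)

theorem aemeasurable_pow_mul (p : ℝ) {w : Space d → ℝ} (hw : Continuous w) (f : L2 d) :
    AEMeasurable (fun x ↦ ‖f x‖ₑ ^ p * ENNReal.ofReal (w x)) volume :=
  ((Lp.aestronglyMeasurable f).enorm.pow_const _).mul hw.measurable.ennreal_ofReal.aemeasurable

/-- Lower semicontinuity in `L²`, by Fatou's lemma. It is what makes `s ↦ ∫ |v(s)|^p w` measurable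
for `v ∈ C(ℝ; L²)`. -/
theorem lowerSemicontinuous_weightedPow {p : ℝ} {w : Space d → ℝ} (hw : Continuous w) :
    LowerSemicontinuous (weightedPow p w) := by
  rw [lowerSemicontinuous_iff_isClosed_preimage]
  intro c
  refine IsSeqClosed.isClosed fun f g hf hfg ↦ ?_
  have h1 : TendstoInMeasure volume (fun n ↦ (f n : Space d → ℂ)) atTop g :=
    tendstoInMeasure_of_tendsto_Lp hfg
  obtain ⟨ns, -, hns⟩ := h1.exists_seq_tendsto_ae
  calc weightedPow p w g
      ≤ ∫⁻ x, liminf (fun n ↦ ‖f (ns n) x‖ₑ ^ p * ENNReal.ofReal (w x)) atTop := by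
        refine lintegral_mono_ae ?_
        filter_upwards [hns] with x hx
        refine (Tendsto.liminf_eq ?_).ge
        refine ENNReal.Tendsto.mul_const ?_ (Or.inr ENNReal.ofReal_ne_top)
        exact ((ENNReal.continuous_rpow_const (y := p)).tendsto _).comp
          ((continuous_enorm.tendsto _).comp hx)
    _ ≤ liminf (fun n ↦ weightedPow p w (f (ns n))) atTop := lintegral_liminf_le' fun n ↦
        aemeasurable_pow_mul p hw _
    _ ≤ c := by
        refine liminf_le_of_le (by isBoundedDefault) fun b hb ↦ ?_
        obtain ⟨n, hn⟩ := hb.exists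
        exact hn.trans (hf (ns n))

theorem measurable_weightedPow {p : ℝ} {w : Space d → ℝ} (hw : Continuous w) {v : ℝ → L2 d}
    (hv : Continuous v) : Measurable fun s ↦ weightedPow p w (v s) :=
  ((lowerSemicontinuous_weightedPow hw).comp hv).measurable

theorem weightedPow_mono {p : ℝ} {w w' : Space d → ℝ} (h : ∀ x, w x ≤ w' x) (f : L2 d) :
    weightedPow p w f ≤ weightedPow p w' f :=
  lintegral_mono fun x ↦ by gcongr; exact h x

theorem weightedPow_weight_succ (p : ℝ) (n : ℕ) (R : ℝ) (f : L2 d) :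
    weightedPow p (weight d (n + 1) R) f = weightedPow p (weight d n R) f +
      ENNReal.ofReal (scaleRatio d ^ (n + 1)) * weightedPow p (scaleGaussian d R (n + 1)) f := by
  have hc : 0 ≤ scaleRatio d ^ (n + 1) := pow_nonneg (scaleRatio_pos d).le _
  unfold weightedPow
  rw [← lintegral_const_mul'' _ (aemeasurable_pow_mul p (continuous_scaleGaussian R _) f),
    ← lintegral_add_left' (aemeasurable_pow_mul p (continuous_weight n R) f)]
  refine lintegral_congr fun x ↦ ?_
  rw [weight_succ, ENNReal.ofReal_add (weight_nonneg n R x)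
    (mul_nonneg hc (scaleGaussian_pos R _ x).le), ENNReal.ofReal_mul hc]
  ring

theorem weightedPow_le_add {p M : ℝ} (hp : 0 ≤ p) {w : Space d → ℝ}
    (hw : Continuous w) (hwM : ∀ x, w x ≤ M) (f : L2 d) :
    weightedPow p w f ≤ (∫⁻ x, ENNReal.ofReal (w x)) +
      ENNReal.ofReal M * ∫⁻ x, ‖f x‖ₑ ^ (p + 1) := by
  rw [← lintegral_const_mul'' _ ((Lp.aestronglyMeasurable f).enorm.pow_const _), weightedPow,
    ← lintegral_add_left hw.measurable.ennreal_ofReal]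
  refine lintegral_mono fun x ↦ ?_
  have h : ‖f x‖ₑ ^ p ≤ 1 + ‖f x‖ₑ ^ (p + 1) := by
    rcases le_total ‖f x‖ₑ 1 with h | h
    · exact (ENNReal.rpow_le_one h hp).trans le_self_add
    · exact (ENNReal.rpow_le_rpow_of_exponent_le h (by linarith)).trans le_add_self
  calc _ ≤ (1 + ‖f x‖ₑ ^ (p + 1)) * ENNReal.ofReal (w x) := by gcongr
    _ = ENNReal.ofReal (w x) + ENNReal.ofReal (w x) * ‖f x‖ₑ ^ (p + 1) := by ring
    _ ≤ _ := by gcongr; exact hwM x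

/-- Hölder's inequality with respect to the measure `w dx`. -/
theorem lintegral_mul_weight_le {p : ℝ} (hp : 1 < p) {w : Space d → ℝ} (hw : Continuous w)
    (f : L2 d) :
    ∫⁻ x, ‖f x‖ₑ * ENNReal.ofReal (w x) ≤
      weightedPow p w f ^ (1 / p) * (∫⁻ x, ENNReal.ofReal (w x)) ^ (1 - 1 / p) := by
  have hp0 : 0 < p := by linarith
  have hpq := Real.HolderConjugate.conjExponent hp
  set q := p.conjExponent
  have hq0 : 0 < q := hpq.symm.pos
  have hq : 1 - 1 / p = 1 / q := by have := hpq.inv_add_inv_eq_one; simp only [one_div]; linarith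
  have hwm : Measurable fun x ↦ ENNReal.ofReal (w x) := hw.measurable.ennreal_ofReal
  have h := ENNReal.lintegral_mul_le_Lp_mul_Lq volume hpq
    (f := fun x ↦ ‖f x‖ₑ * ENNReal.ofReal (w x) ^ (1 / p))
    (g := fun x ↦ ENNReal.ofReal (w x) ^ (1 / q))
    ((Lp.aestronglyMeasurable f).enorm.mul (hwm.pow_const _).aemeasurable)
    (hwm.pow_const _).aemeasurable
  rw [hq]
  convert h using 2
  · funext x
    simp only [Pi.mul_apply]
    rw [mul_assoc, ← ENNReal.rpow_add_of_nonneg _ _ (by positivity) (by positivity), ← hq,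
      show 1 / p + (1 - 1 / p) = 1 by ring, ENNReal.rpow_one]
  · congr 1
    refine lintegral_congr fun x ↦ ?_
    rw [ENNReal.mul_rpow_of_nonneg _ _ hp0.le, ← ENNReal.rpow_mul, one_div_mul_cancel hp0.ne',
      ENNReal.rpow_one]
  · congr 1
    refine lintegral_congr fun x ↦ ?_
    rw [← ENNReal.rpow_mul, one_div_mul_cancel hq0.ne', ENNReal.rpow_one]

/-! ### An integral inequality -/

/-- Young's inequality with a free parameter `l`. -/
theorem young_scaled {p : ℝ} (hp : 1 < p) {B l : ℝ} (hB : 0 ≤ B) (hl : 0 < l) (y : ℝ≥0∞) :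
    ENNReal.ofReal B * y ^ (1 / p) ≤ ENNReal.ofReal l * y +
      ENNReal.ofReal (B ^ p.conjExponent * l ^ (-(p.conjExponent - 1))) := by
  have hp0 : 0 < p := by linarith
  have hpq := Real.HolderConjugate.conjExponent hp
  set m := p.conjExponent with hm
  have hm1 : 1 < m := hpq.symm.lt
  have h := ENNReal.young_inequality (ENNReal.ofReal (l ^ (1 / p)) * y ^ (1 / p))
    (ENNReal.ofReal (B * l ^ (-(1 / p)))) hpq
  have h1 : ENNReal.ofReal (l ^ (1 / p)) * y ^ (1 / p) * ENNReal.ofReal (B * l ^ (-(1 / p))) =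
      ENNReal.ofReal B * y ^ (1 / p) := by
    rw [mul_right_comm, ← ENNReal.ofReal_mul (by positivity)]
    congr 2
    rw [mul_left_comm, ← Real.rpow_add hl]
    simp
  have h2 : (ENNReal.ofReal (l ^ (1 / p)) * y ^ (1 / p)) ^ p = ENNReal.ofReal l * y := by
    rw [ENNReal.mul_rpow_of_nonneg _ _ hp0.le, ENNReal.ofReal_rpow_of_nonneg (by positivity) hp0.le,
      ← Real.rpow_mul hl.le, ← ENNReal.rpow_mul, one_div_mul_cancel hp0.ne', Real.rpow_one,
      ENNReal.rpow_one]
  have h3 : ENNReal.ofReal (B * l ^ (-(1 / p))) ^ m = ENNReal.ofReal (B ^ m * l ^ (-(m - 1))) := by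
    rw [ENNReal.ofReal_rpow_of_nonneg (by positivity) (by linarith),
      Real.mul_rpow hB (by positivity),
      ← Real.rpow_mul hl.le]
    congr 4
    have := hpq.div_conj_eq_sub_one
    have h4 := hpq.symm.div_conj_eq_sub_one
    rw [← h4]
    ring
  have hdiv : ∀ (z : ℝ≥0∞) (r : ℝ), 1 < r → z / ENNReal.ofReal r ≤ z := fun z r hr ↦
    ENNReal.div_le_of_le_mul (le_mul_of_one_le_right' (ENNReal.one_le_ofReal.mpr hr.le))
  rw [h1, h2, h3] at h
  exact h.trans (add_le_add (hdiv _ _ hp) (hdiv _ _ hm1))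

theorem lintegral_rpow_weight {m T s : ℝ} (hm : 1 < m) (hs : s ≤ T) :
    ∫⁻ t in Ioo s T, ENNReal.ofReal (m * (T - t) ^ (m - 1)) = ENNReal.ofReal ((T - s) ^ m) := by
  have hc : Continuous fun t : ℝ ↦ m * (T - t) ^ (m - 1) :=
    continuous_const.mul ((continuous_const.sub continuous_id).rpow_const
      fun _ ↦ Or.inr (by linarith))
  rw [← ofReal_integral_eq_lintegral_ofReal]
  · congr 1
    rw [← integral_Ioc_eq_integral_Ioo, ← intervalIntegral.integral_of_le hs,
      intervalIntegral.integral_const_mul,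
      intervalIntegral.integral_comp_sub_left (fun t ↦ t ^ (m - 1)) T,
      integral_rpow (Or.inl (by linarith))]
    simp only [sub_self, sub_add_cancel]
    rw [Real.zero_rpow (by linarith), sub_zero]
    field_simp
  · exact (hc.integrableOn_Icc).mono_set Ioo_subset_Icc_self
  · refine (ae_restrict_iff' measurableSet_Ioo).mpr (Eventually.of_forall fun t ht ↦ ?_)
    have : 0 ≤ T - t := by linarith [ht.2]
    simp only [Pi.zero_apply]
    positivity

/-- Integration by parts for the weight `(T - t)^m`, in the form of Tonelli's theorem. -/
theorem lintegral_weight_mul_lintegral {m T : ℝ} (hm : 1 < m) {Y : ℝ → ℝ≥0∞}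
    (hY : Measurable Y) :
    ∫⁻ t in Ioo 0 T, ENNReal.ofReal (m * (T - t) ^ (m - 1)) * ∫⁻ s in Ioo 0 t, Y s =
      ∫⁻ s in Ioo 0 T, ENNReal.ofReal ((T - s) ^ m) * Y s := by
  set ω : ℝ → ℝ≥0∞ := fun t ↦ ENNReal.ofReal (m * (T - t) ^ (m - 1)) with hω
  have hωm : Measurable ω := by
    rw [hω]; fun_prop
  have hlt : MeasurableSet {q : ℝ × ℝ | q.2 < q.1} := measurableSet_lt measurable_snd measurable_fst
  have h1 : ∀ t ∈ Ioo 0 T, ω t * ∫⁻ s in Ioo 0 t, Y s =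
      ∫⁻ s in Ioo 0 T, {q : ℝ × ℝ | q.2 < q.1}.indicator (fun q ↦ ω q.1 * Y q.2) (t, s) := by
    intro t ht
    have h3 : ∀ s, {q : ℝ × ℝ | q.2 < q.1}.indicator (fun q ↦ ω q.1 * Y q.2) (t, s) =
        (Iio t).indicator (fun s ↦ ω t * Y s) s := fun s ↦ by
      simp [indicator_apply]
    simp_rw [h3]
    rw [setLIntegral_indicator measurableSet_Iio, ← lintegral_const_mul _ hY]
    congr 2
    ext s
    simp only [mem_inter_iff, mem_Iio, mem_Ioo]
    exact ⟨fun h ↦ ⟨h.2, h.1, h.2.trans ht.2⟩, fun h ↦ ⟨h.2.1, h.1⟩⟩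
  have h2 : ∀ s ∈ Ioo 0 T, ENNReal.ofReal ((T - s) ^ m) * Y s =
      ∫⁻ t in Ioo 0 T, {q : ℝ × ℝ | q.2 < q.1}.indicator (fun q ↦ ω q.1 * Y q.2) (t, s) := by
    intro s hs
    have h3 : ∀ t, {q : ℝ × ℝ | q.2 < q.1}.indicator (fun q ↦ ω q.1 * Y q.2) (t, s) =
        (Ioi s).indicator (fun t ↦ ω t * Y s) t := fun t ↦ by
      simp [indicator_apply]
    simp_rw [h3]
    rw [setLIntegral_indicator measurableSet_Ioi, lintegral_mul_const _ hωm,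
      ← lintegral_rpow_weight hm hs.2.le]
    congr 3
    ext t
    simp only [mem_inter_iff, mem_Ioi, mem_Ioo]
    exact ⟨fun h ↦ ⟨h.1, hs.1.trans h.1, h.2⟩, fun h ↦ ⟨h.1, h.2.2⟩⟩
  rw [setLIntegral_congr_fun measurableSet_Ioo h1, setLIntegral_congr_fun measurableSet_Ioo h2]
  exact lintegral_lintegral_swap
    (((hωm.comp measurable_fst).mul (hY.comp measurable_snd)).indicator hlt).aemeasurable

/-- A priori bound from the integral inequality `∫₀ᵗ Y ≤ A + B Y(t)^{1/p}`, `p > 1`: solutions of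
the corresponding differential inequality blow up in finite time, so that existence up to `T`
limits the size of `∫ Y` on the first half of the interval. -/
theorem lintegral_le_of_le_add_rpow {p : ℝ} (hp : 1 < p) {T : ℝ} (hT : 0 < T) {Y : ℝ → ℝ≥0∞}
    (hY : Measurable Y) (hfin : ∫⁻ s in Ioo 0 T, Y s ≠ ∞) {A B : ℝ} (hA : 0 ≤ A) (hB : 0 ≤ B)
    (h : ∀ t ∈ Ioo 0 T,
      ∫⁻ s in Ioo 0 t, Y s ≤ ENNReal.ofReal A + ENNReal.ofReal B * Y t ^ (1 / p)) :
    ∫⁻ s in Ioo 0 (T / 2), Y s ≤ ENNReal.ofReal (2 ^ (p.conjExponent + 1) *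
      (A + (2 * p.conjExponent) ^ p.conjExponent * B ^ p.conjExponent *
        T ^ (1 - p.conjExponent))) := by
  have hpq := Real.HolderConjugate.conjExponent hp
  set m := p.conjExponent with hm
  have hm1 : 1 < m := hpq.symm.lt
  set Z := ∫⁻ s in Ioo 0 T, ENNReal.ofReal ((T - s) ^ m) * Y s with hZ
  have hrm : Measurable fun t : ℝ ↦ ENNReal.ofReal ((T - t) ^ m) := by fun_prop
  have hrY : Measurable fun t : ℝ ↦ ENNReal.ofReal ((T - t) ^ m) * Y t := hrm.mul hY
  -- multiply by `m (T - t)^{m-1}` and absorb half of the right-hand side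
  have hpt : ∀ t ∈ Ioo 0 T, ENNReal.ofReal (m * (T - t) ^ (m - 1)) * ∫⁻ s in Ioo 0 t, Y s ≤
      ENNReal.ofReal A * ENNReal.ofReal (m * (T - t) ^ (m - 1)) +
        (2⁻¹ * (ENNReal.ofReal ((T - t) ^ m) * Y t) + ENNReal.ofReal ((2 * m) ^ m * B ^ m)) := by
    intro t ht
    have htT : 0 < T - t := by linarith [ht.2]
    have hl : 0 < (T - t) / (2 * m) := by positivity
    have hω : 0 ≤ m * (T - t) ^ (m - 1) := by positivity
    have h1 := (h t ht).trans (add_le_add_right (young_scaled hp hB hl (Y t)) _)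
    rw [← hm] at h1
    refine (mul_le_mul_right h1 _).trans ?_
    rw [mul_add, mul_add, mul_comm (ENNReal.ofReal (m * _)) (ENNReal.ofReal A), ← mul_assoc,
      ← mul_assoc 2⁻¹, ← ENNReal.ofReal_mul hω, ← ENNReal.ofReal_mul hω]
    gcongr ?_ + (?_ * _ + ?_)
    · exact le_rfl
    · refine le_of_eq ?_
      rw [show (2⁻¹ : ℝ≥0∞) = ENNReal.ofReal 2⁻¹ by
        rw [ENNReal.ofReal_inv_of_pos two_pos, ENNReal.ofReal_ofNat],
        ← ENNReal.ofReal_mul (by norm_num)]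
      congr 1
      have : (T - t) ^ m = (T - t) ^ (m - 1) * (T - t) := by
        rw [← Real.rpow_add_one htT.ne', sub_add_cancel]
      rw [this]
      field_simp
    · refine ENNReal.ofReal_le_ofReal (le_of_eq_of_le (b := m * (2 * m) ^ (m - 1) * B ^ m) ?_ ?_)
      · rw [Real.div_rpow htT.le (by positivity), Real.rpow_neg htT.le,
          Real.rpow_neg (by positivity)]
        have := (Real.rpow_pos_of_pos htT (m - 1)).ne'
        have := (Real.rpow_pos_of_pos (show 0 < 2 * m by positivity) (m - 1)).ne'
        field_simp
      · gcongr
        have h2 : (2 * m) ^ m = (2 * m) ^ (m - 1) * (2 * m) := by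
          rw [← Real.rpow_add_one (by positivity), sub_add_cancel]
        rw [h2]
        nlinarith [Real.rpow_pos_of_pos (show 0 < 2 * m by positivity) (m - 1)]
  have hint : Z ≤ ENNReal.ofReal A * ENNReal.ofReal (T ^ m) +
      (2⁻¹ * Z + ENNReal.ofReal ((2 * m) ^ m * B ^ m) * ENNReal.ofReal T) := by
    have h1 := lintegral_mono_ae ((ae_restrict_iff' (μ := volume) measurableSet_Ioo).mpr
      (Eventually.of_forall hpt))
    rw [lintegral_weight_mul_lintegral hm1 hY] at h1
    refine h1.trans_eq ?_
    have hωm : Measurable fun t : ℝ ↦ ENNReal.ofReal (m * (T - t) ^ (m - 1)) := by fun_prop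
    rw [lintegral_add_left (hωm.const_mul _), lintegral_add_left (hrY.const_mul _),
      lintegral_const_mul _ hωm, lintegral_const_mul _ hrY,
      lintegral_rpow_weight hm1 hT.le, sub_zero, lintegral_const, Measure.restrict_apply_univ,
      Real.volume_Ioo, sub_zero]
  have hZfin : Z ≠ ∞ := by
    refine ne_top_of_le_ne_top (ENNReal.mul_ne_top (ENNReal.ofReal_ne_top (r := T ^ m)) hfin) ?_
    rw [hZ, ← lintegral_const_mul _ hY]
    refine setLIntegral_mono (hY.const_mul _) fun s hs ↦ ?_
    have : 0 ≤ T - s := by linarith [hs.2]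
    gcongr
    linarith [hs.1]
  have hZle : Z ≤ 2 * (ENNReal.ofReal A * ENNReal.ofReal (T ^ m) +
      ENNReal.ofReal ((2 * m) ^ m * B ^ m) * ENNReal.ofReal T) := by
    set K := ENNReal.ofReal A * ENNReal.ofReal (T ^ m) +
      ENNReal.ofReal ((2 * m) ^ m * B ^ m) * ENNReal.ofReal T with hK
    have h1 : Z ≤ 2⁻¹ * Z + K := by
      refine hint.trans_eq ?_
      rw [hK]; ring
    have h2 : 2⁻¹ * Z + 2⁻¹ * Z ≤ 2⁻¹ * Z + K := by
      rw [← add_mul, ENNReal.inv_two_add_inv_two, one_mul]; exact h1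
    have h3 := (ENNReal.add_le_add_iff_left (ENNReal.mul_ne_top (by simp) hZfin)).mp h2
    calc Z = 2 * (2⁻¹ * Z) := by
          rw [← mul_assoc, ENNReal.mul_inv_cancel (by norm_num) (by norm_num), one_mul]
      _ ≤ 2 * K := by gcongr
  have hZge : ENNReal.ofReal ((T / 2) ^ m) * ∫⁻ s in Ioo 0 (T / 2), Y s ≤ Z := by
    rw [hZ, ← lintegral_const_mul _ hY]
    refine (setLIntegral_mono hrY fun s hs ↦ ?_).trans
      (lintegral_mono_set (Ioo_subset_Ioo_right (by linarith)))
    have h1 : T / 2 ≤ T - s := by linarith [hs.2]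
    change _ * _ ≤ ENNReal.ofReal ((T - s) ^ m) * Y s
    gcongr
  have hT2 : 0 < (T / 2) ^ m := by positivity
  have hfinal := hZge.trans hZle
  rw [mul_comm, ← ENNReal.le_div_iff_mul_le (Or.inl (by simpa using hT2))
    (Or.inl ENNReal.ofReal_ne_top)] at hfinal
  refine hfinal.trans_eq ?_
  rw [← ENNReal.ofReal_mul hA, ← ENNReal.ofReal_mul (by positivity),
    ← ENNReal.ofReal_add (by positivity) (by positivity), ← ENNReal.ofReal_ofNat,
    ← ENNReal.ofReal_mul (by norm_num), ← ENNReal.ofReal_div_of_pos hT2]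
  congr 1
  rw [Real.div_rpow hT.le (by norm_num), Real.rpow_add (by norm_num), Real.rpow_one,
    Real.rpow_sub hT, Real.rpow_one]
  have := (Real.rpow_pos_of_pos hT m).ne'
  field_simp

/-! ### Duhamel's formula tested with the multiscale weight -/

theorem integrable_of_weightedPow_ne_top {p : ℝ} (hp : 0 ≤ p) {w : Space d → ℝ}
    (hw : Continuous w) (hw0 : ∀ x, 0 ≤ w x) {f : L2 d} (h : weightedPow p w f ≠ ∞) :
    Integrable (fun x ↦ ‖f x‖ ^ p * w x) ∧
      ∫ x, ‖f x‖ ^ p * w x = (weightedPow p w f).toReal := by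
  have he : ∀ x, ENNReal.ofReal (‖f x‖ ^ p * w x) = ‖f x‖ₑ ^ p * ENNReal.ofReal (w x) := fun x ↦ by
    rw [ENNReal.ofReal_mul (by positivity), ← ENNReal.ofReal_rpow_of_nonneg (norm_nonneg _) hp,
      ofReal_norm]
  have h0 : ∀ x, 0 ≤ ‖f x‖ ^ p * w x := fun x ↦ mul_nonneg (by positivity) (hw0 x)
  have hm : AEStronglyMeasurable (fun x ↦ ‖f x‖ ^ p * w x) volume :=
    (((Lp.aestronglyMeasurable f).norm.aemeasurable.pow_const p).aestronglyMeasurable).mul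
      hw.aestronglyMeasurable
  constructor
  · refine ⟨hm, ?_⟩
    rw [hasFiniteIntegral_iff_ofReal (Eventually.of_forall h0)]
    simp_rw [he]
    exact h.lt_top
  · rw [integral_eq_lintegral_of_nonneg_ae (Eventually.of_forall h0) hm]
    simp_rw [he]
    rfl

/-- Testing the non-oscillatory condition with a complex number `w` close to a real `φ ≥ 0`. -/
theorem nonOscillatory_mul_le {p c₀ θ C : ℝ} {F : ℂ → ℂ}
    (hosc : ∀ z : ℂ, c₀ * ‖z‖ ^ p ≤ (Complex.exp (θ * Complex.I) * F z).re)
    (hb : ∀ z, ‖F z‖ ≤ C * ‖z‖ ^ p) (z w : ℂ) {φ ψ : ℝ} (hφ : 0 ≤ φ) (hw : ‖w - φ‖ ≤ ψ) :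
    c₀ * (‖z‖ ^ p * φ) ≤ (Complex.exp (θ * Complex.I) * (F z * w)).re + C * (‖z‖ ^ p * ψ) := by
  have h1 : Complex.exp (θ * Complex.I) * (F z * w) =
      Complex.exp (θ * Complex.I) * F z * (φ : ℂ) +
        Complex.exp (θ * Complex.I) * F z * (w - φ) := by ring
  have h2 : -‖Complex.exp (θ * Complex.I) * F z * (w - φ)‖ ≤
      (Complex.exp (θ * Complex.I) * F z * (w - φ)).re :=
    (abs_le.mp (Complex.abs_re_le_norm _)).1
  have h3 : ‖Complex.exp (θ * Complex.I) * F z * (w - φ)‖ ≤ C * ‖z‖ ^ p * ψ := by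
    rw [norm_mul, norm_mul, Complex.norm_exp_ofReal_mul_I, one_mul]
    exact mul_le_mul (hb z) hw (norm_nonneg _) ((norm_nonneg _).trans (hb z))
  rw [h1, Complex.add_re, Complex.re_mul_ofReal]
  have h4 := mul_le_mul_of_nonneg_right (hosc z) hφ
  linarith

/-- At a fixed time, the pairing of `F(f)` with a function close to the weight `φ` is coercive. -/
theorem slice_bounds {p c₀ θ C ε : ℝ} (hp : 1 < p) {F : ℂ → ℂ} (hF : LipschitzType p F)
    (hC : 0 < C)
    (hosc : ∀ z : ℂ, c₀ * ‖z‖ ^ p ≤ (Complex.exp (θ * Complex.I) * F z).re)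
    (hb : ∀ z, ‖F z‖ ≤ C * ‖z‖ ^ p) {φ ψ : Space d → ℝ} (hφ : Continuous φ) (hψ : Continuous ψ)
    (hφ0 : ∀ x, 0 ≤ φ x) (hφψ : ∀ x, φ x ≤ ψ x) {f w : L2 d} (hf : weightedPow p ψ f ≠ ∞)
    (hw : ∀ᵐ x, ‖w x - (φ x : ℂ)‖ ≤ ε * ψ x) :
    Integrable (fun x ↦ ‖f x‖ ^ p * ‖w x‖) ∧
      ‖∫ x, F (f x) * w x‖ ≤ C * (1 + ε) * (weightedPow p ψ f).toReal ∧
      c₀ * (weightedPow p φ f).toReal ≤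
        (Complex.exp (θ * Complex.I) * ∫ x, F (f x) * w x).re +
          C * ε * (weightedPow p ψ f).toReal := by
  have hp0 : 0 ≤ p := by linarith
  have hψ0 : ∀ x, 0 ≤ ψ x := fun x ↦ (hφ0 x).trans (hφψ x)
  obtain ⟨hi, hiv⟩ := integrable_of_weightedPow_ne_top hp0 hψ hψ0 hf
  have hf' : weightedPow p φ f ≠ ∞ := ne_top_of_le_ne_top hf (weightedPow_mono hφψ f)
  obtain ⟨hi', hiv'⟩ := integrable_of_weightedPow_ne_top hp0 hφ hφ0 hf'
  have hw' : ∀ᵐ x, ‖w x‖ ≤ (1 + ε) * ψ x := by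
    filter_upwards [hw] with x hx
    have h1 : ‖w x‖ ≤ ‖w x - (φ x : ℂ)‖ + ‖(φ x : ℂ)‖ := by
      simpa using norm_add_le (w x - (φ x : ℂ)) (φ x : ℂ)
    rw [Complex.norm_real, Real.norm_of_nonneg (hφ0 x)] at h1
    linarith [hφψ x]
  have hint : Integrable (fun x ↦ ‖f x‖ ^ p * ‖w x‖) := by
    refine (hi.const_mul (1 + ε)).mono' ?_ ?_
    · exact (((Lp.aestronglyMeasurable f).norm.aemeasurable.pow_const p).aestronglyMeasurable).mul
        (Lp.aestronglyMeasurable w).norm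
    · filter_upwards [hw'] with x hx
      rw [Real.norm_of_nonneg (by positivity)]
      calc _ ≤ ‖f x‖ ^ p * ((1 + ε) * ψ x) := by gcongr
        _ = _ := by ring
  have hFw : Integrable (fun x ↦ F (f x) * w x) := by
    refine (hint.const_mul C).mono' ?_ (Eventually.of_forall fun x ↦ ?_)
    · exact ((hF.continuous hp).comp_aestronglyMeasurable (Lp.aestronglyMeasurable f)).mul
        (Lp.aestronglyMeasurable w)
    · rw [norm_mul, ← mul_assoc]
      gcongr
      exact hb _
  refine ⟨hint, ?_, ?_⟩
  · rw [← hiv, ← integral_const_mul]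
    refine norm_integral_le_of_norm_le (hi.const_mul _) ?_
    filter_upwards [hw'] with x hx
    rw [norm_mul]
    calc _ ≤ C * ‖f x‖ ^ p * ((1 + ε) * ψ x) := by gcongr; exact hb _
      _ = _ := by ring
  · rw [← hiv, ← hiv', ← integral_const_mul, ← integral_const_mul, ← integral_const_mul]
    have hre : (∫ x, Complex.exp (θ * Complex.I) * (F (f x) * w x)).re =
        ∫ x, (Complex.exp (θ * Complex.I) * (F (f x) * w x)).re :=
      (integral_re (hFw.const_mul _)).symm
    rw [hre]
    refine le_of_le_of_eq (integral_mono_ae (hi'.const_mul c₀)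
      ((hFw.const_mul (Complex.exp (θ * Complex.I))).re.add (hi.const_mul (C * ε))) ?_)
      (integral_add (hFw.const_mul _).re (hi.const_mul _))
    filter_upwards [hw] with x hx
    have := nonOscillatory_mul_le hosc hb (f x) (w x) (hφ0 x) hx
    change c₀ * (‖f x‖ ^ p * φ x) ≤
      (Complex.exp (θ * Complex.I) * (F (f x) * w x)).re + C * ε * (‖f x‖ ^ p * ψ x)
    linarith

/-- Duhamel's formula, tested with the multiscale weight: up to a contribution of the coarsest
scale, the space-time integral of `|u|^p` against the weight is controlled by the pairings of `u(t)`
and `U(t) u₀` with the weight. -/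
theorem duhamel_lower_bound {p c₀ θ C ε δ : ℝ} (hp : 1 < p) {F : ℂ → ℂ} (hF : LipschitzType p F)
    (hC : 0 < C) (hc₀ : 0 < c₀) (hCε : C * ε ≤ c₀ / 2)
    (hosc : ∀ z : ℂ, c₀ * ‖z‖ ^ p ≤ (Complex.exp (θ * Complex.I) * F z).re)
    (hb : ∀ z, ‖F z‖ ≤ C * ‖z‖ ^ p)
    (hδ : ∀ (n : ℕ) (R : ℝ) (hR : 0 < R) (t : ℝ), 0 ≤ t → t ≤ δ * R ^ 2 →
      ∀ᵐ x : Space d, ‖U t ((weightSchwartz d n hR).toLp 2 volume) x - (weight d n R x : ℂ)‖ ≤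
        ε * weight d (n + 1) R x)
    {u₀ : L2 d} {v : ℝ → L2 d} (hv : Continuous v) (n : ℕ) {R : ℝ} (hR : 0 < R) {t : ℝ}
    (ht : 0 ≤ t) (htR : t ≤ δ * R ^ 2)
    (hduh : ∫ x, v t x * weightSchwartz d n hR x =
      (∫ x, U t u₀ x * weightSchwartz d n hR x) -
        Complex.I * ∫ s in (0 : ℝ)..t,
          ∫ x, F (v s x) * U (t - s) ((weightSchwartz d n hR).toLp 2 volume) x)
    (hfin : ∫⁻ s in Ioo 0 t, weightedPow p (weight d (n + 1) R) (v s) ≠ ∞) :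
    ENNReal.ofReal (c₀ / 2) * ∫⁻ s in Ioo 0 t, weightedPow p (weight d n R) (v s) ≤
      ‖∫ x, v t x * weightSchwartz d n hR x‖ₑ + ‖∫ x, U t u₀ x * weightSchwartz d n hR x‖ₑ +
        ENNReal.ofReal (c₀ / 2) * (ENNReal.ofReal (scaleRatio d ^ (n + 1)) *
          ∫⁻ s in Ioo 0 t, weightedPow p (scaleGaussian d R (n + 1)) (v s)) := by
  set φL := (weightSchwartz d n hR).toLp 2 volume with hφL
  set Y := fun s ↦ weightedPow p (weight d n R) (v s) with hY
  set Y' := fun s ↦ weightedPow p (weight d (n + 1) R) (v s) with hY'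
  have hYm : Measurable Y := measurable_weightedPow (continuous_weight n R) hv
  have hYm' : Measurable Y' := measurable_weightedPow (continuous_weight (n + 1) R) hv
  have hYY' : ∀ s, Y s ≤ Y' s := fun s ↦ weightedPow_mono (weight_le_succ n R) _
  have hfinY : ∫⁻ s in Ioo 0 t, Y s ≠ ∞ := ne_top_of_le_ne_top hfin (lintegral_mono hYY')
  set h := fun s ↦ ∫ x, F (v s x) * U (t - s) φL x with hh
  have hslice : ∀ᵐ s ∂volume.restrict (Ioo 0 t),
      Integrable (fun x ↦ ‖v s x‖ ^ p * ‖U (t - s) φL x‖) ∧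
      ‖h s‖ ≤ C * (1 + ε) * (Y' s).toReal ∧
      c₀ * (Y s).toReal ≤ (Complex.exp (θ * Complex.I) * h s).re + C * ε * (Y' s).toReal := by
    filter_upwards [ae_lt_top hYm' hfin, ae_restrict_mem measurableSet_Ioo] with s hs hst
    exact slice_bounds hp hF hC hosc hb (continuous_weight n R) (continuous_weight (n + 1) R)
      (weight_nonneg n R) (weight_le_succ n R) hs.ne
      (hδ n R hR (t - s) (by linarith [hst.2]) (by linarith [hst.1]))
  have hhm : AEStronglyMeasurable h (volume.restrict (Ioo 0 t)) :=
    aestronglyMeasurable_integral_nonlinear hp hF hv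
      ((continuous_U φL).comp (continuous_const.sub continuous_id)) (hslice.mono fun _ hs ↦ hs.1)
  have hYi : Integrable (fun s ↦ (Y s).toReal) (volume.restrict (Ioo 0 t)) :=
    integrable_toReal_of_lintegral_ne_top hYm.aemeasurable hfinY
  have hYi' : Integrable (fun s ↦ (Y' s).toReal) (volume.restrict (Ioo 0 t)) :=
    integrable_toReal_of_lintegral_ne_top hYm'.aemeasurable hfin
  have hhi : Integrable h (volume.restrict (Ioo 0 t)) :=
    (hYi'.const_mul (C * (1 + ε))).mono' hhm (hslice.mono fun _ hs ↦ hs.2.1)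
  have hreal : c₀ * (∫⁻ s in Ioo 0 t, Y s).toReal ≤
      ‖∫ s in Ioo 0 t, h s‖ + C * ε * (∫⁻ s in Ioo 0 t, Y' s).toReal := by
    rw [← integral_toReal hYm.aemeasurable (ae_lt_top hYm hfinY),
      ← integral_toReal hYm'.aemeasurable (ae_lt_top hYm' hfin)]
    have h1 : c₀ * ∫ s in Ioo 0 t, (Y s).toReal ≤
        ∫ s in Ioo 0 t, ((Complex.exp (θ * Complex.I) * h s).re + C * ε * (Y' s).toReal) := by
      rw [← integral_const_mul]
      exact integral_mono_ae (hYi.const_mul _) ((hhi.const_mul _).re.add (hYi'.const_mul _))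
        (hslice.mono fun _ hs ↦ hs.2.2)
    have h2 : ∫ s in Ioo 0 t, ((Complex.exp (θ * Complex.I) * h s).re + C * ε * (Y' s).toReal) =
        (Complex.exp (θ * Complex.I) * ∫ s in Ioo 0 t, h s).re +
          C * ε * ∫ s in Ioo 0 t, (Y' s).toReal := by
      have h3 := integral_add (hhi.const_mul (Complex.exp (θ * Complex.I))).re
        (hYi'.const_mul (C * ε))
      have h4 : (∫ s in Ioo 0 t, Complex.exp (θ * Complex.I) * h s).re =
        ∫ s in Ioo 0 t, (Complex.exp (θ * Complex.I) * h s).re :=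
        (integral_re (hhi.const_mul _)).symm
      rw [← integral_const_mul, h4, ← integral_const_mul]
      exact h3
    have h5 : (Complex.exp (θ * Complex.I) * ∫ s in Ioo 0 t, h s).re ≤ ‖∫ s in Ioo 0 t, h s‖ := by
      refine (Complex.re_le_norm _).trans_eq ?_
      rw [norm_mul, Complex.norm_exp_ofReal_mul_I, one_mul]
    linarith
  have hnorm : ‖∫ s in Ioo 0 t, h s‖ ≤ ‖∫ x, v t x * weightSchwartz d n hR x‖ +
      ‖∫ x, U t u₀ x * weightSchwartz d n hR x‖ := by
    rw [intervalIntegral.integral_of_le ht, integral_Ioc_eq_integral_Ioo] at hduh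
    have h1 : ‖∫ s in Ioo 0 t, h s‖ = ‖Complex.I * ∫ s in Ioo 0 t, h s‖ := by simp
    have h2 : Complex.I * ∫ s in Ioo 0 t, h s = (∫ x, U t u₀ x * weightSchwartz d n hR x) -
        ∫ x, v t x * weightSchwartz d n hR x := by
      rw [hduh]; ring
    rw [h1, h2, add_comm]
    exact norm_sub_le _ _
  set G := fun s ↦ weightedPow p (scaleGaussian d R (n + 1)) (v s) with hG
  have hGm : Measurable G := measurable_weightedPow (continuous_scaleGaussian R (n + 1)) hv
  have hsplit : ∫⁻ s in Ioo 0 t, Y' s = (∫⁻ s in Ioo 0 t, Y s) +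
      ENNReal.ofReal (scaleRatio d ^ (n + 1)) * ∫⁻ s in Ioo 0 t, G s := by
    rw [← lintegral_const_mul _ hGm, ← lintegral_add_left hYm]
    exact lintegral_congr fun s ↦ weightedPow_weight_succ p n R (v s)
  set X := ∫⁻ s in Ioo 0 t, Y s with hX
  set E := ENNReal.ofReal (scaleRatio d ^ (n + 1)) * ∫⁻ s in Ioo 0 t, G s with hE
  have hEfin : E ≠ ∞ := ne_top_of_le_ne_top hfin (hsplit ▸ le_add_self)
  rw [hsplit, ENNReal.toReal_add hfinY hEfin] at hreal
  have hfinal : c₀ / 2 * X.toReal ≤ ‖∫ x, v t x * weightSchwartz d n hR x‖ +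
      ‖∫ x, U t u₀ x * weightSchwartz d n hR x‖ + c₀ / 2 * E.toReal := by
    have h1 : C * ε * (X.toReal + E.toReal) ≤ c₀ / 2 * (X.toReal + E.toReal) := by gcongr
    linarith
  have h6 := ENNReal.ofReal_le_ofReal hfinal
  rw [ENNReal.ofReal_add (by positivity) (by positivity),
    ENNReal.ofReal_add (by positivity) (by positivity), ENNReal.ofReal_mul (by positivity),
    ENNReal.ofReal_mul (by positivity), ENNReal.ofReal_toReal hfinY, ENNReal.ofReal_toReal hEfin,
    ofReal_norm, ofReal_norm] at h6
  exact h6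

/-! ### The initial datum and the coarsest scale -/

/-- A solution is in `L^{p+1}_loc` in space-time, since the time exponent `q₀` is at least
`p + 1`. -/
theorem IsSolution.lintegral_pow_ne_top {p : ℝ} (hp : 1 < p) {F : ℂ → ℂ} {u₀ : L2 d}
    {u : ℝ → L2 d} (hu : IsSolution p F (Ici 0) u₀ u)
    (hq : p + 1 ≤ 4 * (p + 1) / (d * (p - 1))) (T : ℝ) :
    ∫⁻ s in Ioo 0 T, ∫⁻ x, ‖u s x‖ₑ ^ (p + 1) ≠ ∞ := by
  have hp1 : 0 < p + 1 := by linarith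
  set q := 4 * (p + 1) / (d * (p - 1)) with hqdef
  have hq0 : 0 < q := by linarith
  have h := hu.locallyIntegrable (Icc 0 T) Icc_subset_Ici_self isCompact_Icc
  unfold mixedNorm at h
  rw [eLpNorm_lt_top_iff_lintegral_rpow_enorm_lt_top (by simpa using hq0) ENNReal.ofReal_ne_top,
    ENNReal.toReal_ofReal hq0.le] at h
  refine ne_of_lt (lt_of_le_of_lt ?_ (ENNReal.add_lt_top.mpr
    ⟨(measure_Icc_lt_top (μ := volume) (a := (0 : ℝ)) (b := T)), h⟩))
  calc ∫⁻ s in Ioo 0 T, ∫⁻ x, ‖u s x‖ₑ ^ (p + 1)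
      ≤ ∫⁻ s in Icc 0 T, ∫⁻ x, ‖u s x‖ₑ ^ (p + 1) := lintegral_mono_set Ioo_subset_Icc_self
    _ ≤ ∫⁻ s in Icc 0 T, (1 + ‖eLpNorm (u s) (ENNReal.ofReal (p + 1)) volume‖ₑ ^ q) := by
        refine lintegral_mono fun s ↦ ?_
        have h1 : ∫⁻ x, ‖u s x‖ₑ ^ (p + 1) =
            eLpNorm (u s) (ENNReal.ofReal (p + 1)) volume ^ (p + 1) := by
          rw [eLpNorm_eq_lintegral_rpow_enorm_toReal (by simpa using hp1) ENNReal.ofReal_ne_top,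
            ENNReal.toReal_ofReal hp1.le, ← ENNReal.rpow_mul, one_div_mul_cancel hp1.ne',
            ENNReal.rpow_one]
        rw [h1, enorm_eq_self]
        rcases le_total (eLpNorm (u s) (ENNReal.ofReal (p + 1)) volume) 1 with h2 | h2
        · exact (ENNReal.rpow_le_one h2 hp1.le).trans le_self_add
        · exact (ENNReal.rpow_le_rpow_of_exponent_le h2 hq).trans le_add_self
    _ = _ := by
        rw [lintegral_add_left measurable_const, lintegral_const, Measure.restrict_apply_univ,
          one_mul]

theorem scaleRatio_mul_pow (d : ℕ) : scaleRatio d * 2 ^ d = (2 : ℝ)⁻¹ := by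
  unfold scaleRatio; rw [pow_succ]; field_simp

theorem scaleRatio_le (d : ℕ) : scaleRatio d ≤ (2 : ℝ)⁻¹ := by
  rw [← scaleRatio_mul_pow d]
  exact le_mul_of_one_le_right (scaleRatio_pos d).le (one_le_pow₀ (by norm_num))

/-- The contribution of the coarsest scale tends to zero as the number of scales grows. -/
theorem exists_coarse_scale_le {p : ℝ} (hp : 1 < p) {v : ℝ → L2 d} (T : ℝ)
    (hV : ∫⁻ s in Ioo 0 T, ∫⁻ x, ‖v s x‖ₑ ^ (p + 1) ≠ ∞) {R : ℝ} (hR : 0 < R) :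
    ∃ n : ℕ, ENNReal.ofReal (scaleRatio d ^ (n + 1)) *
      ∫⁻ s in Ioo 0 T, weightedPow p (scaleGaussian d R (n + 1)) (v s) ≤ 1 := by
  set V := ∫⁻ s in Ioo 0 T, ∫⁻ x, ‖v s x‖ₑ ^ (p + 1)
  set M : ℝ := Real.pi ^ (d / 2 : ℝ) * R ^ d with hM
  have hM0 : 0 ≤ M := by positivity
  set K : ℝ := M * max T 0 + V.toReal with hK
  have hK0 : 0 ≤ K := by positivity
  have hint : ∀ k, ∫⁻ x, ENNReal.ofReal (scaleGaussian d R k x) =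
      ENNReal.ofReal (M * (2 ^ d) ^ k) := fun k ↦ by
    rw [← ofReal_integral_eq_lintegral_ofReal (integrable_scaleGaussian hR k)
      (Eventually.of_forall fun x ↦ (scaleGaussian_pos R k x).le), integral_scaleGaussian hR]
  have hbound : ∀ k, ENNReal.ofReal (scaleRatio d ^ k) *
      ∫⁻ s in Ioo 0 T, weightedPow p (scaleGaussian d R k) (v s) ≤
        ENNReal.ofReal ((2 : ℝ)⁻¹ ^ k * K) := by
    intro k
    have h1 : ∫⁻ s in Ioo 0 T, weightedPow p (scaleGaussian d R k) (v s) ≤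
        ENNReal.ofReal (M * (2 ^ d) ^ k * max T 0 + V.toReal) := by
      calc _ ≤ ∫⁻ s in Ioo 0 T, (ENNReal.ofReal (M * (2 ^ d) ^ k) + ∫⁻ x, ‖v s x‖ₑ ^ (p + 1)) := by
            refine lintegral_mono fun s ↦ ?_
            have := weightedPow_le_add (p := p) (M := 1) (by linarith)
              (continuous_scaleGaussian R k) (scaleGaussian_le_one hR k) (v s)
            rwa [hint, ENNReal.ofReal_one, one_mul] at this
        _ = ENNReal.ofReal (M * (2 ^ d) ^ k) * ENNReal.ofReal (max T 0) + V := by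
            rw [lintegral_add_left measurable_const, lintegral_const, Measure.restrict_apply_univ,
              Real.volume_Ioo, sub_zero]
            congr 2
            rcases le_total T 0 with hT | hT
            · rw [max_eq_right hT, ENNReal.ofReal_of_nonpos hT, ENNReal.ofReal_zero]
            · rw [max_eq_left hT]
        _ = _ := by
            rw [ENNReal.ofReal_add (by positivity) ENNReal.toReal_nonneg,
              ENNReal.ofReal_mul (p := M * (2 ^ d) ^ k) (by positivity), ENNReal.ofReal_toReal hV]
    have hc0 := pow_nonneg (scaleRatio_pos d).le k
    refine (mul_le_mul_right h1 _).trans ?_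
    rw [← ENNReal.ofReal_mul hc0]
    refine ENNReal.ofReal_le_ofReal ?_
    have h2 : scaleRatio d ^ k * (2 ^ d) ^ k = (2 : ℝ)⁻¹ ^ k := by
      rw [← mul_pow, scaleRatio_mul_pow]
    have h3 : scaleRatio d ^ k ≤ (2 : ℝ)⁻¹ ^ k :=
      pow_le_pow_left₀ (scaleRatio_pos d).le (scaleRatio_le d) k
    have h4 : scaleRatio d ^ k * V.toReal ≤ (2 : ℝ)⁻¹ ^ k * V.toReal := by gcongr
    calc _ = (scaleRatio d ^ k * (2 ^ d) ^ k) * (M * max T 0) + scaleRatio d ^ k * V.toReal := by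
          ring
      _ ≤ (2 : ℝ)⁻¹ ^ k * (M * max T 0) + (2 : ℝ)⁻¹ ^ k * V.toReal := by rw [h2]; gcongr
      _ = _ := by rw [hK]; ring
  have hlim : Tendsto (fun k : ℕ ↦ (2 : ℝ)⁻¹ ^ k * K) atTop (𝓝 0) := by
    simpa using (tendsto_pow_atTop_nhds_zero_of_lt_one (r := (2 : ℝ)⁻¹) (by norm_num)
      (by norm_num)).mul_const K
  obtain ⟨n, hn⟩ := ((tendsto_add_atTop_iff_nat 1).mpr hlim |>.eventually
    (ge_mem_nhds one_pos)).exists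
  exact ⟨n, (hbound (n + 1)).trans (ENNReal.ofReal_le_one.mpr hn)⟩

/-- Gaussian decay measured in powers of `⟨x⟩`. -/
theorem exists_exp_neg_le_rpow (d : ℕ) {γ : ℝ} (hγ : 0 ≤ γ) (hγd : γ ≤ d) :
    ∃ K : ℝ, 0 < K ∧ ∀ ρ : ℝ, 1 ≤ ρ → ∀ x : Space d,
      Real.exp (-(ρ ^ 2)⁻¹ * ‖x‖ ^ 2) ≤ K * ρ ^ γ * Real.sqrt (1 + ‖x‖ ^ 2) ^ (-γ) := by
  obtain ⟨C, hC⟩ := exists_pow_mul_exp_neg_mul_sq_le d one_pos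
  have hC0 : 0 < C := lt_of_lt_of_le (by simp) (hC 0 le_rfl)
  refine ⟨Real.exp 1 * C, by positivity, fun ρ hρ x ↦ ?_⟩
  have hρ0 : 0 < ρ := by linarith
  set J := Real.sqrt (1 + ‖x‖ ^ 2) with hJ
  have hJ0 : 0 < J := Real.sqrt_pos.mpr (by positivity)
  have hJ2 : J ^ 2 = 1 + ‖x‖ ^ 2 := Real.sq_sqrt (by positivity)
  set r := J / ρ with hr
  have hr0 : 0 < r := by positivity
  have h1 : Real.exp (-(ρ ^ 2)⁻¹ * ‖x‖ ^ 2) ≤ Real.exp 1 * Real.exp (-1 * r ^ 2) := by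
    rw [← Real.exp_add, Real.exp_le_exp, hr, div_pow, hJ2]
    have : (ρ ^ 2)⁻¹ ≤ 1 := inv_le_one_of_one_le₀ (one_le_pow₀ hρ)
    rw [div_eq_mul_inv]
    linarith
  have h2 : r ^ γ * Real.exp (-1 * r ^ 2) ≤ C := by
    refine le_trans ?_ (hC r hr0.le)
    gcongr
    calc r ^ γ ≤ (1 + r) ^ γ := by gcongr; linarith
      _ ≤ (1 + r) ^ (d : ℝ) := Real.rpow_le_rpow_of_exponent_le (by linarith) hγd
      _ = _ := Real.rpow_natCast _ _
  have h3 : r ^ γ = (ρ ^ γ)⁻¹ * J ^ γ := by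
    rw [hr, Real.div_rpow hJ0.le hρ0.le, div_eq_inv_mul]
  have h4 : Real.exp (-1 * r ^ 2) ≤ C * ρ ^ γ * J ^ (-γ) := by
    rw [h3] at h2
    rw [Real.rpow_neg hJ0.le]
    have hρg := Real.rpow_pos_of_pos hρ0 γ
    have hJg := Real.rpow_pos_of_pos hJ0 γ
    rw [← div_eq_mul_inv, le_div_iff₀ hJg]
    rw [mul_assoc, inv_mul_le_iff₀ hρg] at h2
    linarith
  calc _ ≤ _ := h1
    _ ≤ Real.exp 1 * (C * ρ ^ γ * J ^ (-γ)) := by gcongr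
    _ = _ := by ring

/-- By the Cauchy–Schwarz inequality, `𝓕H^α` embeds into the `L¹` space with weight `⟨x⟩^{-γ}`. -/
theorem MemFH.lintegral_ne_top {α γ : ℝ} {f : L2 d} (hf : MemFH α f)
    (hγ : (d : ℝ) / 2 < γ + α) :
    ∫⁻ x, ‖f x‖ₑ * ENNReal.ofReal (Real.sqrt (1 + ‖x‖ ^ 2) ^ (-γ)) ≠ ∞ := by
  have hJ0 : ∀ x : Space d, 0 < Real.sqrt (1 + ‖x‖ ^ 2) := fun x ↦ Real.sqrt_pos.mpr (by positivity)
  have hJc : Continuous fun x : Space d ↦ ((Real.sqrt (1 + ‖x‖ ^ 2) ^ (-(γ + α)) : ℝ) : ℂ) := by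
    refine Complex.continuous_ofReal.comp ?_
    exact (by fun_prop : Continuous fun x : Space d ↦ Real.sqrt (1 + ‖x‖ ^ 2)).rpow_const
      fun x ↦ Or.inl (hJ0 x).ne'
  have hg : MemLp (fun x : Space d ↦ ((Real.sqrt (1 + ‖x‖ ^ 2) ^ (-(γ + α)) : ℝ) : ℂ)) 2
      volume := by
    rw [memLp_two_iff_integrable_sq_norm hJc.aestronglyMeasurable]
    refine (integrable_rpow_neg_one_add_norm_sq (E := Space d) (μ := volume)
      (r := 2 * (γ + α)) (by rw [finrank_euclideanSpace_fin]; linarith)).congr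
      (Eventually.of_forall fun x ↦ ?_)
    have h0 : 0 ≤ 1 + ‖x‖ ^ 2 := by positivity
    simp only [Complex.norm_real]
    rw [Real.norm_of_nonneg (Real.rpow_nonneg (hJ0 x).le _),
      ← Real.rpow_mul_natCast (hJ0 x).le, Real.sqrt_eq_rpow, ← Real.rpow_mul h0]
    congr 1
    push_cast; ring
  have h := (hf.integrable_mul hg).2
  rw [hasFiniteIntegral_iff_enorm] at h
  refine ne_of_lt (lt_of_le_of_lt (lintegral_mono fun x ↦ le_of_eq ?_) h)
  have hJ := hJ0 x
  rw [← ofReal_norm, ← ENNReal.ofReal_mul (norm_nonneg _), ← ofReal_norm]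
  congr 1
  simp only [Pi.mul_apply, norm_mul, Complex.norm_real]
  rw [Real.norm_of_nonneg (by positivity), Real.norm_of_nonneg (by positivity), mul_right_comm,
    ← Real.rpow_add hJ]
  rw [show α + -(γ + α) = -γ by ring, mul_comm]

/-- The pairing of a datum in `𝓕H^α` with the multiscale weight, uniformly in the number of
scales. -/
theorem MemFH.exists_lintegral_mul_weight_le {α γ : ℝ} {f : L2 d} (hf : MemFH α f)
    (hγ : (d : ℝ) / 2 < γ + α) (hγ0 : 0 ≤ γ) (hγd : γ ≤ d) :
    ∃ K : ℝ, 0 ≤ K ∧ ∀ (n : ℕ) (R : ℝ), 1 ≤ R →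
      ∫⁻ x, ‖f x‖ₑ * ENNReal.ofReal (weight d n R x) ≤ ENNReal.ofReal (K * R ^ γ) := by
  obtain ⟨C, hC, h⟩ := exists_exp_neg_le_rpow d hγ0 hγd
  set I := ∫⁻ x, ‖f x‖ₑ * ENNReal.ofReal (Real.sqrt (1 + ‖x‖ ^ 2) ^ (-γ)) with hI
  have hIfin : I ≠ ∞ := hf.lintegral_ne_top hγ
  refine ⟨2 * C * I.toReal, by positivity, fun n R hR ↦ ?_⟩
  have hw : ∀ x : Space d, weight d n R x ≤
      2 * C * R ^ γ * Real.sqrt (1 + ‖x‖ ^ 2) ^ (-γ) := by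
    intro x
    have hk : ∀ k, scaleRatio d ^ k * scaleGaussian d R k x ≤
        (2 : ℝ)⁻¹ ^ k * (C * R ^ γ * Real.sqrt (1 + ‖x‖ ^ 2) ^ (-γ)) := by
      intro k
      have h2k : (1 : ℝ) ≤ 2 ^ k := one_le_pow₀ (by norm_num)
      have h1 := h (2 ^ k * R) (by nlinarith) x
      have h2 : ((2 ^ k * R) ^ 2)⁻¹ = scaleCoeff R k := by
        unfold scaleCoeff
        rw [mul_pow, ← pow_mul, mul_comm k, pow_mul]; norm_num
      rw [h2, Real.mul_rpow (by positivity) (by linarith)] at h1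
      have h3 : ((2 : ℝ) ^ k) ^ γ ≤ (2 ^ d) ^ k := by
        calc ((2 : ℝ) ^ k) ^ γ ≤ ((2 : ℝ) ^ k) ^ (d : ℝ) :=
              Real.rpow_le_rpow_of_exponent_le h2k hγd
          _ = _ := by rw [Real.rpow_natCast, ← pow_mul, ← pow_mul, mul_comm]
      have h4 : scaleRatio d ^ k * (2 ^ d) ^ k = (2 : ℝ)⁻¹ ^ k := by
        rw [← mul_pow, scaleRatio_mul_pow]
      have hc0 := pow_nonneg (scaleRatio_pos d).le k
      calc scaleRatio d ^ k * scaleGaussian d R k x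
          ≤ scaleRatio d ^ k * (C * (((2 : ℝ) ^ k) ^ γ * R ^ γ) *
              Real.sqrt (1 + ‖x‖ ^ 2) ^ (-γ)) := mul_le_mul_of_nonneg_left h1 hc0
        _ ≤ scaleRatio d ^ k * (C * ((2 ^ d) ^ k * R ^ γ) *
              Real.sqrt (1 + ‖x‖ ^ 2) ^ (-γ)) := by gcongr
        _ = (scaleRatio d ^ k * (2 ^ d) ^ k) *
              (C * R ^ γ * Real.sqrt (1 + ‖x‖ ^ 2) ^ (-γ)) := by ring
        _ = _ := by rw [h4]
    refine (Finset.sum_le_sum fun k _ ↦ hk k).trans ?_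
    rw [← Finset.sum_mul]
    have := sum_geometric_two_le' (n + 1)
    calc _ ≤ 2 * (C * R ^ γ * Real.sqrt (1 + ‖x‖ ^ 2) ^ (-γ)) := by gcongr
      _ = _ := by ring
  have hA : 0 ≤ 2 * C * R ^ γ := by positivity
  calc _ ≤ ∫⁻ x, ENNReal.ofReal (2 * C * R ^ γ) *
        (‖f x‖ₑ * ENNReal.ofReal (Real.sqrt (1 + ‖x‖ ^ 2) ^ (-γ))) := by
        refine lintegral_mono fun x ↦ ?_
        rw [mul_left_comm, ← ENNReal.ofReal_mul hA]
        gcongr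
        exact hw x
    _ = ENNReal.ofReal (2 * C * R ^ γ) * I := by
        rw [lintegral_const_mul' _ _ ENNReal.ofReal_ne_top]
    _ = _ := by
        rw [← ENNReal.ofReal_toReal hIfin, ← ENNReal.ofReal_mul hA]
        congr 1
        rw [ENNReal.toReal_ofReal ENNReal.toReal_nonneg]; ring

/-! ### The upper bound at parabolic scale -/

theorem lintegral_weight_le {R : ℝ} (hR : 0 < R) (n : ℕ) :
    ∫⁻ x : Space d, ENNReal.ofReal (weight d n R x) ≤
      ENNReal.ofReal (2 * Real.pi ^ (d / 2 : ℝ) * R ^ d) := by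
  rw [← ofReal_integral_eq_lintegral_ofReal (integrable_weight hR n)
    (Eventually.of_forall (weight_nonneg n R))]
  exact ENNReal.ofReal_le_ofReal (integral_weight_le hR n)

theorem enorm_integral_mul_weight_le {p : ℝ} (hp : 1 < p) (n : ℕ) {R : ℝ} (hR : 0 < R)
    (f : L2 d) :
    ‖∫ x, f x * weightSchwartz d n hR x‖ₑ ≤
      ENNReal.ofReal ((2 * Real.pi ^ (d / 2 : ℝ) * R ^ d) ^ (1 - 1 / p)) *
        weightedPow p (weight d n R) f ^ (1 / p) := by
  have h1 : (0 : ℝ) ≤ 1 - 1 / p := by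
    have : 1 / p ≤ 1 := by rw [div_le_one (by linarith)]; exact hp.le
    linarith
  calc _ ≤ ∫⁻ x, ‖f x * weightSchwartz d n hR x‖ₑ := enorm_integral_le_lintegral_enorm _
    _ = ∫⁻ x, ‖f x‖ₑ * ENNReal.ofReal (weight d n R x) := by
        refine lintegral_congr fun x ↦ ?_
        rw [enorm_mul, weightSchwartz_apply, ← ofReal_norm (weight d n R x : ℂ), Complex.norm_real,
          Real.norm_of_nonneg (weight_nonneg n R x)]
    _ ≤ weightedPow p (weight d n R) f ^ (1 / p) *
          (∫⁻ x : Space d, ENNReal.ofReal (weight d n R x)) ^ (1 - 1 / p) :=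
        lintegral_mul_weight_le hp (continuous_weight n R) f
    _ ≤ weightedPow p (weight d n R) f ^ (1 / p) *
          ENNReal.ofReal (2 * Real.pi ^ (d / 2 : ℝ) * R ^ d) ^ (1 - 1 / p) := by
        gcongr
        exact lintegral_weight_le hR n
    _ = _ := by
        rw [ENNReal.ofReal_rpow_of_nonneg (by positivity) h1, mul_comm]

theorem enorm_integral_U_mul_weight_le {ε δ : ℝ} (hε : 0 < ε)
    (hδ : ∀ (n : ℕ) (R : ℝ) (hR : 0 < R) (t : ℝ), 0 ≤ t → t ≤ δ * R ^ 2 →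
      ∀ᵐ x : Space d, ‖U t ((weightSchwartz d n hR).toLp 2 volume) x - (weight d n R x : ℂ)‖ ≤
        ε * weight d (n + 1) R x)
    (n : ℕ) {R : ℝ} (hR : 0 < R) {t : ℝ} (ht : 0 ≤ t) (htR : t ≤ δ * R ^ 2) (f : L2 d) :
    ‖∫ x, U t f x * weightSchwartz d n hR x‖ₑ ≤
      ENNReal.ofReal (1 + ε) * ∫⁻ x, ‖f x‖ₑ * ENNReal.ofReal (weight d (n + 1) R x) := by
  rw [integral_U_mul_weight, ← lintegral_const_mul' _ _ ENNReal.ofReal_ne_top]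
  refine (enorm_integral_le_lintegral_enorm _).trans (lintegral_mono_ae ?_)
  filter_upwards [hδ n R hR t ht htR] with x hx
  rw [enorm_mul, mul_left_comm, ← ENNReal.ofReal_mul (by positivity)]
  gcongr
  rw [← ofReal_norm]
  refine ENNReal.ofReal_le_ofReal ?_
  have h1 : ‖U t ((weightSchwartz d n hR).toLp 2 volume) x‖ ≤
      ‖U t ((weightSchwartz d n hR).toLp 2 volume) x - (weight d n R x : ℂ)‖ +
        ‖(weight d n R x : ℂ)‖ := by
    simpa using norm_add_le (U t ((weightSchwartz d n hR).toLp 2 volume) x -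
      (weight d n R x : ℂ)) (weight d n R x : ℂ)
  rw [Complex.norm_real, Real.norm_of_nonneg (weight_nonneg n R x)] at h1
  linarith [weight_le_succ n R x]

/-- The extension of a solution to negative times by its initial value is continuous. -/
theorem IsSolution.continuous_extend {p : ℝ} {F : ℂ → ℂ} {u₀ : L2 d} {u : ℝ → L2 d}
    (hu : IsSolution p F (Ici 0) u₀ u) : Continuous fun s : ℝ ↦ u (max s 0) :=
  hu.continuousOn.comp_continuous (by fun_prop) fun s ↦ le_max_right s 0

/-- Upper bound for the space-time integral of `|u|^p` over the parabolic region `0 < t ≲ R²`,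
`|x| ≲ R`. -/
theorem IsSolution.exists_upper_bound {p : ℝ} (hp : 1 < p) {F : ℂ → ℂ} (hF : LipschitzType p F)
    (hF₂ : NonOscillatory p F) {u₀ : L2 d} {u : ℝ → L2 d} (hu : IsSolution p F (Ici 0) u₀ u)
    (hq : p + 1 ≤ 4 * (p + 1) / (d * (p - 1))) {α γ : ℝ} (hu₀ : MemFH α u₀)
    (hγ : (d : ℝ) / 2 < γ + α) (hγ0 : 0 ≤ γ) (hγd : γ ≤ d) :
    ∃ K δ : ℝ, 0 ≤ K ∧ 0 < δ ∧ ∀ R : ℝ, 1 ≤ R →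
      ∫⁻ s in Ioo 0 (δ * R ^ 2), weightedPow p (scaleGaussian d R 0) (u (max s 0)) ≤
        ENNReal.ofReal (K * (R ^ γ + R ^ ((d : ℝ) + 2 - 2 * p.conjExponent))) := by
  obtain ⟨c₀, θ, hc₀, hosc⟩ := hF₂
  obtain ⟨C, hC, -, hb⟩ := hF.exists_bounds hp
  have hε : 0 < c₀ / (2 * C) := by positivity
  set ε := c₀ / (2 * C) with hεdef
  have hCε : C * ε ≤ c₀ / 2 := le_of_eq (by rw [hεdef]; field_simp)
  obtain ⟨δ, hδ0, hδ⟩ := exists_norm_U_weight_sub_le d hε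
  obtain ⟨K₀, hK₀, hdatum⟩ := hu₀.exists_lintegral_mul_weight_le hγ hγ0 hγd
  have hpq := Real.HolderConjugate.conjExponent hp
  set m := p.conjExponent with hm
  have hm1 : 1 < m := hpq.symm.lt
  have hpm : (1 - 1 / p) * m = 1 := by
    have h1 := hpq.inv_add_inv_eq_one
    rw [one_div, show 1 - p⁻¹ = m⁻¹ by linarith]
    exact inv_mul_cancel₀ (by linarith)
  set P : ℝ := 2 * Real.pi ^ (d / 2 : ℝ) with hP
  have hP0 : 0 < P := by positivity
  set v : ℝ → L2 d := fun s ↦ u (max s 0) with hv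
  have hvc : Continuous v := hu.continuous_extend
  set K₁ : ℝ := 2 / c₀ * ((1 + ε) * K₀) + 1 with hK₁
  set K₂ : ℝ := (2 * m) ^ m * (2 / c₀) ^ m * P * δ ^ (1 - m) with hK₂
  have hK₁0 : 0 ≤ K₁ := by positivity
  have hK₂0 : 0 ≤ K₂ := by positivity
  refine ⟨2 ^ (m + 1) * (K₁ + K₂), δ / 2, by positivity, by positivity, fun R hR ↦ ?_⟩
  have hR0 : 0 < R := by linarith
  set T := δ * R ^ 2 with hT
  have hT0 : 0 < T := by positivity
  have hV : ∫⁻ s in Ioo 0 T, ∫⁻ x, ‖v s x‖ₑ ^ (p + 1) ≠ ∞ := by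
    refine ne_of_eq_of_ne (setLIntegral_congr_fun measurableSet_Ioo fun s hs ↦ ?_)
      (hu.lintegral_pow_ne_top hp hq T)
    simp only [hv, max_eq_left hs.1.le]
  obtain ⟨n, hn⟩ := exists_coarse_scale_le hp T hV hR0
  have hYfin : ∀ k, ∫⁻ s in Ioo 0 T, weightedPow p (weight d k R) (v s) ≠ ∞ := by
    intro k
    have hle : ∀ x : Space d, weight d k R x ≤ 2 := by
      intro x
      refine le_trans (Finset.sum_le_sum fun j _ ↦ ?_) (sum_geometric_two_le' (k + 1))
      have h1 : scaleRatio d ^ j ≤ (2 : ℝ)⁻¹ ^ j :=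
        pow_le_pow_left₀ (scaleRatio_pos d).le (scaleRatio_le d) j
      have h2 := scaleGaussian_le_one hR0 j x
      have h3 := pow_nonneg (scaleRatio_pos d).le j
      nlinarith
    refine ne_top_of_le_ne_top ?_ (lintegral_mono fun s ↦ weightedPow_le_add (by linarith)
      (continuous_weight k R) hle (v s))
    rw [lintegral_add_left measurable_const, lintegral_const, Measure.restrict_apply_univ,
      lintegral_const_mul' _ _ ENNReal.ofReal_ne_top, Real.volume_Ioo]
    refine ENNReal.add_ne_top.mpr ⟨ENNReal.mul_ne_top ?_ ENNReal.ofReal_ne_top,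
      ENNReal.mul_ne_top ENNReal.ofReal_ne_top hV⟩
    exact ne_top_of_le_ne_top ENNReal.ofReal_ne_top (lintegral_weight_le hR0 k)
  have hX : ∀ t ∈ Ioo 0 T, ∫⁻ s in Ioo 0 t, weightedPow p (weight d n R) (v s) ≤
      ENNReal.ofReal (K₁ * R ^ γ) + ENNReal.ofReal (2 / c₀ * (P * R ^ d) ^ (1 - 1 / p)) *
        weightedPow p (weight d n R) (v t) ^ (1 / p) := by
    intro t ht
    have hduh : ∫ x, v t x * weightSchwartz d n hR0 x =
        (∫ x, U t u₀ x * weightSchwartz d n hR0 x) -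
          Complex.I * ∫ s in (0 : ℝ)..t,
            ∫ x, F (v s x) * U (t - s) ((weightSchwartz d n hR0).toLp 2 volume) x := by
      have h1 := hu.duhamel t ht.1.le (weightSchwartz d n hR0)
      have h2 : ∫ s in (0 : ℝ)..t,
          ∫ x, F (v s x) * U (t - s) ((weightSchwartz d n hR0).toLp 2 volume) x =
          ∫ s in (0 : ℝ)..t,
          ∫ x, F (u s x) * U (t - s) ((weightSchwartz d n hR0).toLp 2 volume) x := by
        refine intervalIntegral.integral_congr fun s hs ↦ ?_
        rw [uIcc_of_le ht.1.le] at hs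
        simp only [hv, max_eq_left hs.1]
      rw [h2]
      simp only [hv, max_eq_left ht.1.le]
      exact h1
    have hsub : Ioo 0 t ⊆ Ioo 0 T := Ioo_subset_Ioo_right ht.2.le
    have h1 := duhamel_lower_bound hp hF hC hc₀ hCε hosc hb hδ hvc n hR0 ht.1.le ht.2.le hduh
      (ne_top_of_le_ne_top (hYfin (n + 1)) (lintegral_mono_set hsub))
    have h2 := enorm_integral_mul_weight_le hp n hR0 (v t)
    have h3 := (enorm_integral_U_mul_weight_le hε hδ n hR0 ht.1.le ht.2.le u₀).trans
      (mul_le_mul_right (hdatum (n + 1) R hR) _)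
    rw [← ENNReal.ofReal_mul (by positivity)] at h3
    have h4 : ENNReal.ofReal (scaleRatio d ^ (n + 1)) *
        ∫⁻ s in Ioo 0 t, weightedPow p (scaleGaussian d R (n + 1)) (v s) ≤ 1 :=
      (mul_le_mul_right (lintegral_mono_set hsub) _).trans hn
    have h5 := h1.trans (add_le_add (add_le_add h2 h3) (mul_le_mul_right h4 _))
    have hc2 : ENNReal.ofReal (2 / c₀) * ENNReal.ofReal (c₀ / 2) = 1 := by
      rw [← ENNReal.ofReal_mul (by positivity), ← ENNReal.ofReal_one]
      congr 1; field_simp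
    have h6 := mul_le_mul_right h5 (ENNReal.ofReal (2 / c₀))
    rw [← mul_assoc, hc2, one_mul] at h6
    refine h6.trans ?_
    rw [mul_add, mul_add, mul_one, hc2, ← mul_assoc, ← ENNReal.ofReal_mul (by positivity),
      ← ENNReal.ofReal_mul (by positivity), add_assoc, add_comm]
    gcongr
    rw [← ENNReal.ofReal_one, ← ENNReal.ofReal_add (by positivity) zero_le_one]
    refine ENNReal.ofReal_le_ofReal ?_
    have hRγ : 1 ≤ R ^ γ := Real.one_le_rpow hR hγ0
    rw [hK₁]
    nlinarith
  have hmain := lintegral_le_of_le_add_rpow hp hT0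
    (measurable_weightedPow (continuous_weight n R) hvc) (hYfin n)
    (A := K₁ * R ^ γ) (B := 2 / c₀ * (P * R ^ d) ^ (1 - 1 / p)) (by positivity) (by positivity) hX
  rw [show δ / 2 * R ^ 2 = T / 2 by rw [hT]; ring]
  refine (lintegral_mono fun s ↦ weightedPow_mono (scaleGaussian_zero_le_weight n R) _).trans
    (hmain.trans (ENNReal.ofReal_le_ofReal ?_))
  rw [mul_assoc (2 ^ (m + 1))]
  refine mul_le_mul_of_nonneg_left ?_ (by positivity)
  have hB : (2 * m) ^ m * (2 / c₀ * (P * R ^ d) ^ (1 - 1 / p)) ^ m * T ^ (1 - m) =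
      K₂ * R ^ ((d : ℝ) + 2 - 2 * m) := by
    have hB1 : (2 / c₀ * (P * R ^ d) ^ (1 - 1 / p)) ^ m = (2 / c₀) ^ m * (P * R ^ d) := by
      rw [Real.mul_rpow (by positivity) (by positivity), ← Real.rpow_mul (by positivity), hpm,
        Real.rpow_one]
    have hT1 : T ^ (1 - m) = δ ^ (1 - m) * R ^ (2 * (1 - m)) := by
      rw [hT, Real.mul_rpow hδ0.le (by positivity), ← Real.rpow_natCast R 2, ← Real.rpow_mul hR0.le]
      norm_num
    rw [hB1, hT1, hK₂, show (d : ℝ) + 2 - 2 * m = (d : ℝ) + 2 * (1 - m) by ring,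
      Real.rpow_add hR0, Real.rpow_natCast]
    ring
  rw [hB]
  have hRγ : 0 ≤ R ^ γ := by positivity
  have hRe : 0 ≤ R ^ ((d : ℝ) + 2 - 2 * m) := by positivity
  nlinarith [mul_nonneg hK₁0 hRe, mul_nonneg hK₂0 hRγ]

/-! ### The lower bound in the light cone -/

/-- An integrable function with vanishing Fourier integral is zero. -/
theorem ae_eq_zero_of_fourier_eq_zero {k : Space d → ℂ} (hk : Integrable k)
    (h : ∀ w, 𝓕 k w = 0) : k =ᵐ[volume] 0 := by
  refine ae_eq_of_integral_mul_schwartz hk.locallyIntegrable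
    (locallyIntegrable_const (0 : ℂ)) fun φ ↦ ?_
  have h1 := VectorFourier.integral_fourierIntegral_smul_eq_flip (L := innerₗ (Space d))
    (μ := volume) (ν := volume) Real.continuous_fourierChar continuous_inner hk
    ((𝓕⁻ φ : 𝓢(Space d, ℂ)).integrable (μ := volume))
  simp only [smul_eq_mul, flip_innerₗ] at h1
  have h2 : ∀ x, VectorFourier.fourierIntegral Real.fourierChar volume (innerₗ (Space d))
      ⇑(𝓕⁻ φ : 𝓢(Space d, ℂ)) x = φ x := fun x ↦ by
    have h3 : 𝓕 (𝓕⁻ φ : 𝓢(Space d, ℂ)) = φ := FourierTransform.fourier_fourierInv_eq φ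
    exact (congrFun (SchwartzMap.fourier_coe (𝓕⁻ φ : 𝓢(Space d, ℂ))) x).symm.trans
      (congrArg (fun ψ : 𝓢(Space d, ℂ) ↦ ψ x) h3)
  have h4 : ∀ x, VectorFourier.fourierIntegral Real.fourierChar volume (innerₗ (Space d)) k x = 0 :=
    h
  simp only [h2, h4, zero_mul, integral_zero] at h1
  rw [← h1]
  simp

/-- The translates of a Gaussian are total in `L²`. -/
theorem eq_zero_of_inner_gaussianL2_eq_zero {a : ℝ} (ha : 0 < a) {f : L2 d}
    (h : ∀ y, inner ℂ (gaussianL2 ha y) f = 0) : f = 0 := by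
  set b : ℂ := ((Real.pi ^ 2 / a : ℝ) : ℂ) with hb
  have hbre : 0 < b.re := by rw [hb, Complex.ofReal_re]; positivity
  have hc : (((Real.pi / a : ℝ) : ℂ) ^ (d / 2 : ℂ)) ≠ 0 := by
    have : ((Real.pi / a : ℝ) : ℂ) ≠ 0 := by
      exact_mod_cast (div_pos Real.pi_pos ha).ne'
    exact fun h0 ↦ this ((Complex.cpow_eq_zero_iff _ _).mp h0).1
  set k : Space d → ℂ := fun ξ ↦ fourierGaussian b 0 ξ * (𝓕 f : L2 d) ξ with hk
  have hki : Integrable k := (memLp_fourierGaussian hbre 0).integrable_mul (Lp.memLp _)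
  have hF : ∀ w, 𝓕 k w = 0 := by
    intro w
    have h1 := h (-w)
    rw [gaussianL2, inner_smul_left, mul_eq_zero] at h1
    replace h1 := h1.resolve_left (by simpa using hc)
    rw [← Lp.inner_fourier_eq, FourierTransform.fourier_fourierInv_eq, L2.inner_def] at h1
    rw [Real.fourier_eq', ← h1]
    refine integral_congr_ae ?_
    filter_upwards [(memLp_fourierGaussian hbre (-w)).coeFn_toLp] with ξ hξ
    rw [hξ, RCLike.inner_apply, smul_eq_mul, hk]
    simp only [fourierGaussian]
    rw [← Complex.exp_conj, ← mul_assoc, ← Complex.exp_add, mul_comm ((𝓕 f : L2 d) ξ)]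
    congr 2
    simp only [hb, Complex.ofReal_mul, Complex.ofReal_neg, Complex.ofReal_ofNat,
      neg_zero, inner_zero_left, Complex.ofReal_zero, mul_zero, add_zero, map_add, map_mul, map_neg,
      map_pow, Complex.conj_ofReal, Complex.conj_I, map_ofNat, neg_neg, real_inner_comm]
    ring
  have hk0 := ae_eq_zero_of_fourier_eq_zero hki hF
  have hf0 : (𝓕 f : L2 d) = 0 := by
    rw [Lp.eq_zero_iff_ae_eq_zero]
    filter_upwards [hk0] with ξ hξ
    simpa [hk, fourierGaussian] using hξ
  rw [← norm_eq_zero, ← Lp.norm_fourier_eq, hf0, norm_zero]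

theorem weightedPow_le_eLpNorm {r : ℝ} (hr : 1 < r) {w : Space d → ℝ} (hw : ∀ x, w x ≤ 1)
    (f : L2 d) :
    weightedPow r w f ^ (1 / r) ≤ eLpNorm f (ENNReal.ofReal r) volume := by
  have hr0 : 0 < r := by linarith
  rw [eLpNorm_eq_lintegral_rpow_enorm_toReal (by simpa using hr0) ENNReal.ofReal_ne_top,
    ENNReal.toReal_ofReal hr0.le]
  gcongr
  refine lintegral_mono fun x ↦ ?_
  exact mul_le_of_le_one_right' (ENNReal.ofReal_le_one.mpr (hw x))

/-- The pairing with the freely evolving Gaussian, at times comparable to `ρ`, estimated by Hölder's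
inequality in `L^r` localized to the light cone. -/
theorem exists_enorm_inner_U_gaussian_le (y : Space d) {r : ℝ} (hr : 1 < r) :
    ∃ C : ℝ, 0 < C ∧ ∀ ρ t : ℝ, 1 ≤ ρ → ρ ≤ t → t ≤ 2 * ρ → ∀ f : L2 d,
      ‖inner ℂ (U t (gaussianL2 one_pos y)) f‖ₑ ≤ ENNReal.ofReal (C * ρ ^ ((d : ℝ) / 2 - d / r)) *
        weightedPow r (scaleGaussian d (Real.sqrt 34 * ρ) 0) f ^ (1 / r) := by
  have hr0 : 0 < r := by linarith
  have hr1 : 0 ≤ 1 - 1 / r := by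
    have : 1 / r ≤ 1 := by rw [div_le_one hr0]; exact hr.le
    linarith
  set P : ℝ := Real.pi ^ (d / 2 : ℝ) * Real.sqrt 34 ^ d with hP
  have hP0 : 0 < P := by positivity
  refine ⟨Real.exp (‖y‖ ^ 2) * P ^ (1 - 1 / r), by positivity, fun ρ t hρ ht ht' f ↦ ?_⟩
  have hρ0 : 0 < ρ := by linarith
  have hR : 0 < Real.sqrt 34 * ρ := by positivity
  set w := scaleGaussian d (Real.sqrt 34 * ρ) 0 with hw
  have hwc : Continuous w := continuous_scaleGaussian _ _
  have hA : 0 ≤ Real.exp (‖y‖ ^ 2) * ρ ^ (-(d / 2 : ℝ)) := by positivity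
  have hwint : ∫⁻ x, ENNReal.ofReal (w x) = ENNReal.ofReal (P * ρ ^ d) := by
    rw [← ofReal_integral_eq_lintegral_ofReal (integrable_scaleGaussian hR 0)
      (Eventually.of_forall fun x ↦ (scaleGaussian_pos _ 0 x).le), integral_scaleGaussian hR, hP]
    congr 1
    rw [mul_pow]; ring
  have hg : ∀ᵐ x, ‖U t (gaussianL2 one_pos y) x‖ ≤
      Real.exp (‖y‖ ^ 2) * ρ ^ (-(d / 2 : ℝ)) * w x := by
    filter_upwards [coeFn_U_gaussianL2 one_pos y t] with x hx
    rw [hx]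
    refine (norm_freeGaussian_le y hρ ht ht' x).trans_eq ?_
    rw [hw, scaleGaussian, scaleCoeff, pow_zero, one_mul, mul_pow, Real.sq_sqrt (by norm_num)]
  calc ‖inner ℂ (U t (gaussianL2 one_pos y)) f‖ₑ
      ≤ ∫⁻ x, ‖inner ℂ (U t (gaussianL2 one_pos y) x) (f x)‖ₑ := by
        rw [L2.inner_def]
        exact enorm_integral_le_lintegral_enorm _
    _ ≤ ∫⁻ x, ENNReal.ofReal (Real.exp (‖y‖ ^ 2) * ρ ^ (-(d / 2 : ℝ))) *
          (‖f x‖ₑ * ENNReal.ofReal (w x)) := by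
        refine lintegral_mono_ae ?_
        filter_upwards [hg] with x hx
        rw [mul_left_comm, ← ENNReal.ofReal_mul hA, RCLike.inner_apply, enorm_mul]
        gcongr
        rw [← ofReal_norm, RCLike.norm_conj]
        exact ENNReal.ofReal_le_ofReal hx
    _ ≤ ENNReal.ofReal (Real.exp (‖y‖ ^ 2) * ρ ^ (-(d / 2 : ℝ))) *
          (weightedPow r w f ^ (1 / r) * (∫⁻ x, ENNReal.ofReal (w x)) ^ (1 - 1 / r)) := by
        rw [lintegral_const_mul' _ _ ENNReal.ofReal_ne_top]
        gcongr
        exact lintegral_mul_weight_le hr hwc f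
    _ = _ := by
        rw [hwint, ENNReal.ofReal_rpow_of_nonneg (by positivity) hr1,
          mul_comm (weightedPow r w f ^ _),
          ← mul_assoc, ← ENNReal.ofReal_mul hA]
        congr 2
        rw [Real.mul_rpow hP0.le (by positivity), ← Real.rpow_natCast ρ d, ← Real.rpow_mul hρ0.le,
          show (d : ℝ) / 2 - d / r = -(d / 2) + d * (1 - 1 / r) by ring, Real.rpow_add hρ0]
        ring

/-- Asymptotic freeness in `L^∞` in time makes the remainder small at almost all times. -/
theorem eventually_volume_le_of_tendsto_top {e : ℝ → ℝ≥0∞}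
    (h : Tendsto (fun t : ℝ ↦ eLpNorm e ∞ (volume.restrict (Ioi t))) atTop (𝓝 0)) {η : ℝ≥0∞}
    (hη : 0 < η) :
    ∀ᶠ ρ : ℝ in atTop, ∀ N : Set ℝ, N ⊆ Ioo ρ (2 * ρ) → (∀ s ∈ N, η < e s) →
      volume N ≤ ENNReal.ofReal (ρ / 2) := by
  filter_upwards [h.eventually (ge_mem_nhds hη)] with ρ hρ N hN hNe
  have h1 : ∀ᵐ s ∂volume.restrict (Ioi ρ), e s ≤ η := by
    rw [eLpNorm_exponent_top] at hρ
    filter_upwards [ae_le_eLpNormEssSup (f := e) (μ := volume.restrict (Ioi ρ))] with s hs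
    exact hs.trans hρ
  rw [ae_restrict_iff' measurableSet_Ioi] at h1
  refine le_trans (le_of_eq (measure_mono_null (fun s hs ↦ ?_) h1)) zero_le
  exact fun h2 ↦ absurd (h2 (hN hs).1) (hNe s hs).not_ge

/-- Asymptotic freeness in a weighted `L^q` in time makes the remainder small outside a set of
times of small density, by Chebyshev's inequality. The remainder need not be measurable in time,
so the exceptional times are given as a measurable set. -/
theorem eventually_volume_le_of_tendsto {e : ℝ → ℝ≥0∞} {σ : ℝ} (hσ : 0 < σ)
    (h : Tendsto (fun t : ℝ ↦ ENNReal.ofReal (t ^ (σ / 2)) *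
      eLpNorm e (ENNReal.ofReal (2 / σ)) (volume.restrict (Ioi t))) atTop (𝓝 0)) {η : ℝ≥0∞}
    (hη : 0 < η) (hη' : η ≠ ∞) :
    ∀ᶠ ρ : ℝ in atTop, ∀ N : Set ℝ, MeasurableSet N → N ⊆ Ioo ρ (2 * ρ) →
      (∀ s ∈ N, η < ENNReal.ofReal (ρ ^ σ) * e s) → volume N ≤ ENNReal.ofReal (ρ / 2) := by
  have hq : 0 < 2 / σ := by positivity
  set q := 2 / σ with hqdef
  have hσq : σ * q = 2 := by rw [hqdef]; field_simp
  have hη2 : 0 < (η ^ q / 2) ^ (1 / q) := by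
    refine ENNReal.rpow_pos (ENNReal.div_pos (ENNReal.rpow_pos hη hη').ne' (by norm_num)) ?_
    exact (ENNReal.div_lt_top (ENNReal.rpow_ne_top_of_nonneg hq.le hη') (by norm_num)).ne
  filter_upwards [h.eventually (ge_mem_nhds hη2), eventually_ge_atTop 1] with ρ hρ hρ1
    N hNm hN hNe
  have hρ0 : 0 < ρ := by linarith
  have h1 : ENNReal.ofReal ρ * ∫⁻ s in Ioi ρ, e s ^ q ≤ η ^ q / 2 := by
    have h2 := ENNReal.rpow_le_rpow hρ hq.le
    rw [eLpNorm_eq_lintegral_rpow_enorm_toReal (by simpa using hq) ENNReal.ofReal_ne_top,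
      ENNReal.toReal_ofReal hq.le, ENNReal.mul_rpow_of_nonneg _ _ hq.le, ← ENNReal.rpow_mul,
      ← ENNReal.rpow_mul, one_div_mul_cancel hq.ne', ENNReal.rpow_one, ENNReal.rpow_one,
      ENNReal.ofReal_rpow_of_nonneg (by positivity) hq.le, ← Real.rpow_mul hρ0.le,
      show σ / 2 * q = 1 by linarith, Real.rpow_one] at h2
    simpa using h2
  have h3 : η ^ q * volume N ≤ ENNReal.ofReal (ρ ^ 2) * ∫⁻ s in Ioi ρ, e s ^ q := by
    have hsub : N ⊆ Ioi ρ := fun s hs ↦ (hN hs).1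
    have h4 : η ^ q * volume N ≤ ∫⁻ s in Ioi ρ, ENNReal.ofReal (ρ ^ 2) * e s ^ q := by
      rw [← setLIntegral_const]
      refine (setLIntegral_mono' hNm fun s hs ↦ ?_).trans (lintegral_mono_set hsub)
      have h6 := ENNReal.rpow_le_rpow (hNe s hs).le hq.le
      rwa [ENNReal.mul_rpow_of_nonneg _ _ hq.le,
        ENNReal.ofReal_rpow_of_nonneg (by positivity) hq.le, ← Real.rpow_mul hρ0.le, hσq,
        Real.rpow_two] at h6
    rwa [lintegral_const_mul' _ _ ENNReal.ofReal_ne_top] at h4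
  have h5 : η ^ q * volume N ≤ η ^ q * ENNReal.ofReal (ρ / 2) := by
    calc _ ≤ _ := h3
      _ = ENNReal.ofReal ρ * (ENNReal.ofReal ρ * ∫⁻ s in Ioi ρ, e s ^ q) := by
          rw [← mul_assoc, ← ENNReal.ofReal_mul hρ0.le, sq]
      _ ≤ ENNReal.ofReal ρ * (η ^ q / 2) := by gcongr
      _ = _ := by
          rw [ENNReal.ofReal_div_of_pos two_pos, ENNReal.ofReal_ofNat, div_eq_mul_inv,
            div_eq_mul_inv]
          ring
  exact (ENNReal.mul_le_mul_iff_right (ENNReal.rpow_pos hη hη').ne'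
    (ENNReal.rpow_ne_top_of_nonneg hq.le hη')).mp h5

/-- If `v` is asymptotically free with a nonzero scattering state, then pairing with a freely
evolving Gaussian bounds the localized `L^p` norm of `v` from below, at least for half of the times
in `(ρ, 2ρ)`. -/
theorem exists_lower_bound {p r : ℝ} (hp : 1 < p) (hr : 1 < r) {v : ℝ → L2 d} (hv : Continuous v)
    {f : L2 d} (hf : f ≠ 0)
    (h : ∀ η : ℝ≥0∞, 0 < η → η ≠ ∞ → ∀ᶠ ρ : ℝ in atTop, ∀ N : Set ℝ, MeasurableSet N →
      N ⊆ Ioo ρ (2 * ρ) → (∀ s ∈ N, η < ENNReal.ofReal (ρ ^ ((d : ℝ) / 2 - d / r)) *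
        eLpNorm (v s - U s f) (ENNReal.ofReal r) volume) → volume N ≤ ENNReal.ofReal (ρ / 2)) :
    ∃ c : ℝ, 0 < c ∧ ∀ᶠ ρ : ℝ in atTop, ENNReal.ofReal (c * ρ ^ (1 + (d : ℝ) - d * p / 2)) ≤
      ∫⁻ s in Ioo ρ (2 * ρ), weightedPow p (scaleGaussian d (Real.sqrt 34 * ρ) 0) (v s) := by
  obtain ⟨y, hy⟩ : ∃ y, inner ℂ (gaussianL2 one_pos y) f ≠ 0 := by
    by_contra! h0
    exact hf (eq_zero_of_inner_gaussianL2_eq_zero one_pos h0)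
  set κ : ℝ := ‖inner ℂ (gaussianL2 one_pos y) f‖ with hκ
  have hκ0 : 0 < κ := norm_pos_iff.mpr hy
  have hp0 : 0 < p := by linarith
  obtain ⟨C₁, hC₁, H₁⟩ := exists_enorm_inner_U_gaussian_le y hp
  obtain ⟨C₂, hC₂, H₂⟩ := exists_enorm_inner_U_gaussian_le y hr
  refine ⟨(κ / 2 / C₁) ^ p / 2, by positivity, ?_⟩
  have hη : 0 < ENNReal.ofReal (κ / 2 / C₂) := ENNReal.ofReal_pos.mpr (by positivity)
  filter_upwards [h _ hη ENNReal.ofReal_ne_top, eventually_ge_atTop 1] with ρ hN hρ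
  have hρ0 : 0 < ρ := by linarith
  set Y : ℝ → ℝ≥0∞ := fun s ↦ weightedPow p (scaleGaussian d (Real.sqrt 34 * ρ) 0) (v s) with hY
  have hYm : Measurable Y := measurable_weightedPow (continuous_scaleGaussian _ _) hv
  set S : Set ℝ := Ioo ρ (2 * ρ) ∩
    {s | ENNReal.ofReal (κ / 2) ≤
      ENNReal.ofReal (C₁ * ρ ^ ((d : ℝ) / 2 - d / p)) * Y s ^ (1 / p)} with hS
  have hSm : MeasurableSet S := measurableSet_Ioo.inter
    (measurableSet_le measurable_const ((hYm.pow_const _).const_mul _))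
  have hbad : volume (Ioo ρ (2 * ρ) \ S) ≤ ENNReal.ofReal (ρ / 2) := by
    refine hN _ (measurableSet_Ioo.diff hSm) sdiff_subset fun s hs ↦ ?_
    have h1 : ENNReal.ofReal (C₁ * ρ ^ ((d : ℝ) / 2 - d / p)) * Y s ^ (1 / p) <
        ENNReal.ofReal (κ / 2) := by
      by_contra! h2
      exact hs.2 ⟨hs.1, h2⟩
    -- `⟨g, f⟩ = ⟨U(s) g, U(s) f⟩`, and `U(s) f = v(s) - (v(s) - U(s) f)`
    have h3 : ENNReal.ofReal κ ≤
        ‖inner ℂ (U s (gaussianL2 one_pos y)) (v s)‖ₑ +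
          ‖inner ℂ (U s (gaussianL2 one_pos y)) (v s - U s f)‖ₑ := by
      have h4 : inner ℂ (gaussianL2 one_pos y) f =
          inner ℂ (U s (gaussianL2 one_pos y)) (v s) -
            inner ℂ (U s (gaussianL2 one_pos y)) (v s - U s f) := by
        rw [inner_sub_right, inner_U]; ring
      rw [hκ, ofReal_norm, h4]
      exact enorm_sub_le
    have h5 := H₁ ρ s hρ hs.1.1.le hs.1.2.le (v s)
    have h6 : ‖inner ℂ (U s (gaussianL2 one_pos y)) (v s - U s f)‖ₑ ≤
        ENNReal.ofReal (C₂ * ρ ^ ((d : ℝ) / 2 - d / r)) *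
          eLpNorm (v s - U s f) (ENNReal.ofReal r) volume :=
      (H₂ ρ s hρ hs.1.1.le hs.1.2.le (v s - U s f)).trans (by
        gcongr
        exact weightedPow_le_eLpNorm hr (scaleGaussian_le_one (by positivity) 0) _)
    have h7 : ENNReal.ofReal (κ / 2) < ENNReal.ofReal (C₂ * ρ ^ ((d : ℝ) / 2 - d / r)) *
        eLpNorm (v s - U s f) (ENNReal.ofReal r) volume := by
      refine lt_of_lt_of_le ?_ h6
      by_contra! h8
      have h9 : ENNReal.ofReal κ < ENNReal.ofReal (κ / 2) + ENNReal.ofReal (κ / 2) :=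
        h3.trans_lt (ENNReal.add_lt_add_of_lt_of_le (h8.trans_lt ENNReal.ofReal_lt_top).ne
          (h5.trans_lt h1) h8)
      rw [← ENNReal.ofReal_add (by positivity) (by positivity), add_halves] at h9
      exact lt_irrefl _ h9
    rw [ENNReal.ofReal_div_of_pos hC₂]
    refine ENNReal.div_lt_of_lt_mul' ?_
    rwa [← mul_assoc, ← ENNReal.ofReal_mul hC₂.le]
  have hSvol : ENNReal.ofReal (ρ / 2) ≤ volume S := by
    have h1 : volume (Ioo ρ (2 * ρ)) ≤ volume S + volume (Ioo ρ (2 * ρ) \ S) := by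
      rw [← measure_union disjoint_sdiff_right (measurableSet_Ioo.diff hSm)]
      exact measure_mono (by rw [union_sdiff_self]; exact subset_union_right)
    rw [Real.volume_Ioo, show 2 * ρ - ρ = ρ / 2 + ρ / 2 by ring,
      ENNReal.ofReal_add (by positivity) (by positivity)] at h1
    exact (ENNReal.add_le_add_iff_right ENNReal.ofReal_ne_top).mp
      (h1.trans (add_le_add le_rfl hbad))
  have hSY : ∀ s ∈ S, ENNReal.ofReal ((κ / 2 / (C₁ * ρ ^ ((d : ℝ) / 2 - d / p))) ^ p) ≤ Y s := by
    intro s hs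
    have h1 : ENNReal.ofReal (κ / 2 / (C₁ * ρ ^ ((d : ℝ) / 2 - d / p))) ≤ Y s ^ (1 / p) := by
      rw [ENNReal.ofReal_div_of_pos (by positivity)]
      exact ENNReal.div_le_of_le_mul' hs.2
    have h2 := ENNReal.rpow_le_rpow h1 hp0.le
    rwa [← ENNReal.rpow_mul, one_div_mul_cancel hp0.ne', ENNReal.rpow_one,
      ENNReal.ofReal_rpow_of_nonneg (by positivity) hp0.le] at h2
  calc ENNReal.ofReal ((κ / 2 / C₁) ^ p / 2 * ρ ^ (1 + (d : ℝ) - d * p / 2))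
      = ENNReal.ofReal ((κ / 2 / (C₁ * ρ ^ ((d : ℝ) / 2 - d / p))) ^ p) *
          ENNReal.ofReal (ρ / 2) := by
        rw [← ENNReal.ofReal_mul (by positivity)]
        congr 1
        rw [← div_div, Real.div_rpow (x := κ / 2 / C₁) (by positivity) (by positivity),
          ← Real.rpow_mul hρ0.le,
          show 1 + (d : ℝ) - d * p / 2 = 1 - (d / 2 - d / p) * p by field_simp; ring,
          Real.rpow_sub hρ0, Real.rpow_one]
        ring
    _ ≤ ENNReal.ofReal ((κ / 2 / (C₁ * ρ ^ ((d : ℝ) / 2 - d / p))) ^ p) * volume S := by gcongr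
    _ = ∫⁻ s in S, ENNReal.ofReal ((κ / 2 / (C₁ * ρ ^ ((d : ℝ) / 2 - d / p))) ^ p) :=
        (setLIntegral_const _ _).symm
    _ ≤ ∫⁻ s in S, Y s := setLIntegral_mono' hSm hSY
    _ ≤ ∫⁻ s in Ioo ρ (2 * ρ), Y s := lintegral_mono_set inter_subset_left

/-! ### The Strauss exponent and the conclusion -/

/-- The Strauss exponent is the positive root of `d p² - (d + 2) p = 2`. -/
theorem quadratic_lt_of_lt_straussExponent (hd : 1 ≤ d) {p : ℝ} (hp : 1 < p)
    (hp' : p < straussExponent d) : (d : ℝ) * p ^ 2 - (d + 2) * p < 2 := by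
  have hd' : (1 : ℝ) ≤ d := by exact_mod_cast hd
  rw [straussExponent, lt_div_iff₀ (by positivity)] at hp'
  have hS := Real.sq_sqrt (show (0 : ℝ) ≤ (d : ℝ) ^ 2 + 12 * d + 4 by positivity)
  have hS0 := Real.sqrt_nonneg ((d : ℝ) ^ 2 + 12 * d + 4)
  set S := Real.sqrt ((d : ℝ) ^ 2 + 12 * d + 4)
  rcases le_total (2 * d * p - (d + 2)) 0 with h | h
  · nlinarith
  · have h1 : (2 * d * p - (d + 2)) ^ 2 < S ^ 2 := pow_lt_pow_left₀ (by linarith) h (by norm_num)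
    have h2 : (d : ℝ) * ((d : ℝ) * p ^ 2 - (d + 2) * p - 2) < 0 := by nlinarith
    nlinarith

/-- A solution that is asymptotically free with remainder small in `L^r`, in density of times, has
scattering state zero: the lower bound of order `ρ^(1 + d - dp/2)` is incompatible with the upper
bound from the test function argument. -/
theorem IsSolution.eq_zero_of_eventually_volume_le (hd : 1 ≤ d) {p : ℝ} (hp : 1 < p)
    (hp' : p < straussExponent d) {F : ℂ → ℂ} (hF₁ : LipschitzType p F) (hF₂ : NonOscillatory p F)
    {α : ℝ} (hα : 0 < α) (hα' : 2 / (p - 1) - (d : ℝ) / 2 ≤ α) {u₀ : L2 d} (hu₀ : MemFH α u₀)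
    {u : ℝ → L2 d} (hu : IsSolution p F (Ici 0) u₀ u) {r : ℝ} (hr : 1 < r) {f : L2 d}
    (h : ∀ η : ℝ≥0∞, 0 < η → η ≠ ∞ → ∀ᶠ ρ : ℝ in atTop, ∀ N : Set ℝ, MeasurableSet N →
      N ⊆ Ioo ρ (2 * ρ) → (∀ s ∈ N, η < ENNReal.ofReal (ρ ^ ((d : ℝ) / 2 - d / r)) *
        eLpNorm (u s - U s f) (ENNReal.ofReal r) volume) → volume N ≤ ENNReal.ofReal (ρ / 2)) :
    f = 0 := by
  by_contra hf
  have hd' : (1 : ℝ) ≤ d := by exact_mod_cast hd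
  have hp1 : 0 < p - 1 := by linarith
  have hquad := quadratic_lt_of_lt_straussExponent hd hp hp'
  set e : ℝ := 1 + (d : ℝ) - d * p / 2 with he
  have he0 : 0 < e := by
    by_contra! h0
    nlinarith
  have hde : (d : ℝ) - 2 / (p - 1) < e := by
    have : (d * p / 2 - 1) < 2 / (p - 1) := by
      rw [lt_div_iff₀ hp1]; nlinarith
    linarith
  have hq : p + 1 ≤ 4 * (p + 1) / (d * (p - 1)) := by
    rw [le_div_iff₀ (by positivity), mul_comm]
    have : (d : ℝ) * (p - 1) ≤ 4 := by
      by_contra! h0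
      nlinarith
    exact mul_le_mul_of_nonneg_right this (by linarith)
  -- `d/2 - α ≤ d - 2/(p-1) < e`, so the term `R^γ` of the upper bound can be made negligible
  obtain ⟨γ, hγ1, hγ2⟩ : ∃ γ, max 0 ((d : ℝ) / 2 - α) < γ ∧ γ < min e d := by
    refine exists_between (max_lt (lt_min he0 (by linarith)) (lt_min ?_ ?_)) <;> linarith
  rw [max_lt_iff] at hγ1
  rw [lt_min_iff] at hγ2
  obtain ⟨K, δ, hK, hδ, hupper⟩ := hu.exists_upper_bound hp hF₁ hF₂ hq hu₀
    (show (d : ℝ) / 2 < γ + α by linarith) hγ1.1.le hγ2.2.le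
  have hlower := exists_lower_bound hp hr hu.continuous_extend hf fun η hη hη' ↦ by
    filter_upwards [h η hη hη', eventually_ge_atTop 0] with ρ hN hρ N hNm hNs hNe
    refine hN N hNm hNs fun s hs ↦ ?_
    have hs0 : 0 ≤ s := hρ.trans (hNs hs).1.le
    simpa only [max_eq_left hs0] using hNe s hs
  obtain ⟨c, hc, hlower⟩ := hlower
  have hm : (d : ℝ) + 2 - 2 * p.conjExponent = d - 2 / (p - 1) := by
    rw [Real.conjExponent]; field_simp; ring
  rw [hm] at hupper
  set e' : ℝ := (d : ℝ) - 2 / (p - 1) with he'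
  have h34 : (0 : ℝ) < Real.sqrt 34 := by positivity
  have h34' : Real.sqrt 34 ^ 2 = 34 := Real.sq_sqrt (by norm_num)
  -- both bounds with `R = √34 ρ`; the cone is inside the parabolic region once `34 δ ρ ≥ 2`
  have hbound : ∀ᶠ ρ : ℝ in atTop,
      c ≤ K * (Real.sqrt 34 ^ γ * ρ ^ (-(e - γ)) + Real.sqrt 34 ^ e' * ρ ^ (-(e - e'))) := by
    filter_upwards [hlower, eventually_ge_atTop 1, eventually_ge_atTop (2 / (δ * 34))]
      with ρ h1 hρ hρδ
    have hρ0 : 0 < ρ := by linarith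
    have hR : 1 ≤ Real.sqrt 34 * ρ := by
      have : (1 : ℝ) ≤ Real.sqrt 34 := Real.one_le_sqrt.mpr (by norm_num)
      nlinarith
    have h2 : Ioo ρ (2 * ρ) ⊆ Ioo 0 (δ * (Real.sqrt 34 * ρ) ^ 2) := by
      refine Ioo_subset_Ioo hρ0.le ?_
      rw [div_le_iff₀ (by positivity)] at hρδ
      rw [mul_pow, h34']
      nlinarith
    have h3 := h1.trans ((lintegral_mono_set h2).trans (hupper _ hR))
    rw [ENNReal.ofReal_le_ofReal_iff (by positivity), Real.mul_rpow h34.le hρ0.le,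
      Real.mul_rpow h34.le hρ0.le] at h3
    have h4 : 0 < ρ ^ e := by positivity
    rw [neg_sub, neg_sub, Real.rpow_sub hρ0 γ e, Real.rpow_sub hρ0 e' e]
    refine le_of_mul_le_mul_right (h3.trans_eq ?_) h4
    rw [mul_assoc, add_mul, mul_assoc, mul_assoc, div_mul_cancel₀ _ h4.ne',
      div_mul_cancel₀ _ h4.ne']
  have hlim : Tendsto (fun ρ : ℝ ↦
      K * (Real.sqrt 34 ^ γ * ρ ^ (-(e - γ)) + Real.sqrt 34 ^ e' * ρ ^ (-(e - e'))))
      atTop (𝓝 (K * (Real.sqrt 34 ^ γ * 0 + Real.sqrt 34 ^ e' * 0))) :=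
    (((tendsto_rpow_neg_atTop (sub_pos.mpr hγ2.1)).const_mul _).add
      ((tendsto_rpow_neg_atTop (sub_pos.mpr hde)).const_mul _)).const_mul _
  have := ge_of_tendsto hlim hbound
  simp only [mul_zero, add_zero] at this
  linarith

end NLS

theorem theorem1 (d : ℕ) (hd : 1 ≤ d) (p : ℝ) (hp : 1 < p) (hp' : p < NLS.straussExponent d)
    (F : ℂ → ℂ) (hF₁ : NLS.LipschitzType p F) (hF₂ : NLS.NonOscillatory p F)
    (α : ℝ) (hα : 0 < α) (hα' : 2 / (p - 1) - (d : ℝ) / 2 ≤ α)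
    (u₀ : NLS.L2 d) (hu₀ : NLS.MemFH α u₀)
    (u : ℝ → NLS.L2 d) (hu : NLS.IsSolution p F (Ici 0) u₀ u) (hu0 : u 0 = u₀) :
    (p ≤ 2 → ∀ uplus : NLS.L2 d,
      Tendsto (fun t : ℝ ↦ NLS.mixedNorm ∞ 2 (Ioi t) (fun s ↦ u s - NLS.U s uplus))
        atTop (𝓝 0) →
      uplus = 0) ∧
    (2 < p → d ≤ 2 ∧ ∀ (β : ℝ) (uplus : NLS.L2 d),
      (d : ℝ) / 2 - d / p < β → NLS.MemFH β uplus →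
      Tendsto (fun t : ℝ ↦ ENNReal.ofReal (t ^ ((d : ℝ) * (p - 2) / (4 * p))) *
          NLS.mixedNorm (ENNReal.ofReal (4 * p / (d * (p - 2)))) (ENNReal.ofReal p) (Ioi t)
            (fun s ↦ u s - NLS.U s uplus))
        atTop (𝓝 0) →
      uplus = 0) := by

  refine ⟨fun _ uplus h ↦ ?_, fun hp2 ↦ ⟨?_, fun _ uplus _ _ h ↦ ?_⟩⟩
  · refine hu.eq_zero_of_eventually_volume_le hd hp hp' hF₁ hF₂ hα hα' hu₀ one_lt_two
      fun η hη _ ↦ ?_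
    filter_upwards [NLS.eventually_volume_le_of_tendsto_top h hη] with ρ hρ N _ hNs hNe
    refine hρ N hNs fun s hs ↦ ?_
    simpa only [sub_self, Real.rpow_zero, ENNReal.ofReal_one, one_mul, ENNReal.ofReal_ofNat]
      using hNe s hs
  · have hquad := NLS.quadratic_lt_of_lt_straussExponent hd hp hp'
    by_contra! h0
    have h3 : (3 : ℝ) ≤ d := by exact_mod_cast h0
    nlinarith [mul_nonneg (sub_nonneg.mpr h3) (sub_nonneg.mpr hp2.le)]
  · have hd' : (1 : ℝ) ≤ d := by exact_mod_cast hd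
    have hp2' : 0 < p - 2 := by linarith
    have hσ : (d : ℝ) / 2 - d / p = d * (p - 2) / (2 * p) := by field_simp
    refine hu.eq_zero_of_eventually_volume_le hd hp hp' hF₁ hF₂ hα hα' hu₀ hp
      fun η hη hη' ↦ NLS.eventually_volume_le_of_tendsto ?_ ?_ hη hη'
    · rw [hσ]; positivity
    · rw [hσ, show (d : ℝ) * (p - 2) / (2 * p) / 2 = d * (p - 2) / (4 * p) by field_simp; norm_num,
        show 2 / ((d : ℝ) * (p - 2) / (2 * p)) = 4 * p / (d * (p - 2)) by field_simp; norm_num]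
      exact h
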